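/- **Setting.** Let $X,W$ be real Banach spaces and $U$ a finite-dimensional real normed space. Let $f:X\times U\times W\to X$ and $\ell:X\times U\times W\to\mathbb R$ be continuous. Let $\mathbb X\subseteq X$ and $\mathbb U\subseteq U$ be given by finitely many constraints $g_i(x)\le 0$ (or $g_i(x)=0$) and $h_j(u)\le 0$ (or $h_j(u)=0$), respectively. Let $N\in\mathbb N_0$. For $x\in X$, $u=(u(0),\dots,u(N))\in U^{N+1}$ and $w=(w(0),\dots,w(N))\in W^{N+1}$ let $x(0)=x$, $x(k+1)=f(x(k),u(k),w(k))$ and $$J_N(x,u,w)=\sum_{k=0}^{N}\ell(x(k),u(k),w(k)).$$ A control sequence $u$ is admissible for $(x,w)$ if $x(k+1)\in\mathbb X$ and $u(k)\in\mathbb U$ for $k=0,\dots,N$. Let $\mathbb W\subseteq W$ be a compact set of disturbances, let $\Delta x,\Delta w>0$, and put $\|\bar w-w\|=\max_k\|\bar w(k)-w(k)\|$ for disturbance sequences. For $A\subseteq X$ let $T(A)$ be the set of tuples $(\bar x,x,\bar w,w)$ with $\bar x,x\in A$, $\bar w,w\in\mathbb W^{N+1}$, $\|\bar x-x\|\le\Delta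 x$, $\|\bar w-w\|\le\Delta w$ and $\|\bar w(k+1)-\bar w(k)\|\le\Delta w$ for $0\le k<N$, and let $D(A)$ be the set of nominal data $(x,w)$ that occur in these tuples. **Hypotheses.** Let $A\subseteq\mathbb X$ contain the point $x^\star$, and let $(x,w)\mapsto u^\star(\cdot,x,w)\in U^{N+1}$ be continuous on $D(A)$. Suppose that for every tuple $(\bar x,x,\bar w,w)\in T(A)$ * $u^\star(\cdot,x,w)$ minimises $J_N(x,\cdot,w)$ over the admissible control sequences for $(x,w)$; * $f$, $\ell$ and all $g_i,h_j$ are twice continuously differentiable in a neighbourhood of the nominal solution (the control sequence $u^\star(\cdot,x,w)$ together with its trajectory and $w$); * for the problem of minimising $J_N(x,u,w)$ over $u\in U^{N+1}$ subject to the constraints $g_i(x(k+1))$ and $h_j(u(k))$, $0\le k\le N$, the linear independence constraint qualification, the sufficient second order optimality conditions (with a Lagrange multiplier) and strict complementarity hold at $u^\star(\cdot,x,w)$. **Conclusion.** For every $(x,w)\in D(A)$ there is exactly one bounded linear map $S(x,w)=\left(\frac{\partial u^\star}{\partial x},\frac{\partial u^\star}{\partial w}\right)(\cdot,x,w):X\times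 W^{N+1}\to U^{N+1}$ which is the derivative at $(x,w)$ of a map that assigns to each $(x',w')$ in a neighbourhood of $(x,w)$ in $X\times W^{N+1}$ an admissible local minimiser of the problem with data $(x',w')$ and takes the value $u^\star(\cdot,x,w)$ at $(x,w)$. With the sensitivity update $$\bar u(\cdot,\bar x,\bar w)=u^\star(\cdot,x,w)+S(x,w)(\bar x-x,\bar w-w),\qquad \mu_N(x,w)=u^\star(0,x,w),\quad \bar\mu_N(\bar x,\bar w)=\bar u(0,\bar x,\bar w),$$ the following holds for every compact $K\subseteq A$ with $x^\star\in K$ (so in particular for some set $K\subseteq\mathbb X$ containing $x^\star$, and for $K=A$ if $A$ is compact): there are constants $L_\ell,L_J\ge 0$ such that for all $(\bar x,x,\bar w,w)\in T(K)$ $$|\ell(\bar x,\bar\mu_N(\bar x,\bar w),\bar w(0))-\ell(x,\mu_N(x,w),w(0))|\le L_\ell\left(\|\bar x-x\|+\|\bar w-w\|\right),$$ $$|J_N(\bar x,\bar u(\cdot,\bar x,\bar w),\bar w)-J_N(x,u^\star(\cdot,x,w),w)|\le L_J\left(\|\bar x-x\|+\|\bar w-w\|\right).$$ -/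

import Mathlib

open Topology

namespace MPC

/-! ### Finite-dimensional nonlinear programs

Minimise `F v` subject to `c i v ≤ 0` for all `i` and `c i v = 0` for `i ∈ E`. -/

section NLP

variable {V ι : Type*} [NormedAddCommGroup V] [NormedSpace ℝ V] [Fintype ι]

/-- The feasible points of the constraint system `(c, E)`; the indices in `E` are the equality
constraints. -/
def feasibleSet {V ι : Type*} (c : ι → V → ℝ) (E : Set ι) : Set V :=
  {v | ∀ i, c i v ≤ 0 ∧ (i ∈ E → c i v = 0)}

/-- The Lagrangian `F + ∑ i, mult i * c i`. -/
def lagrangian (F : V → ℝ) (c : ι → V → ℝ) (mult : ι → ℝ) (v : V) : ℝ :=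
  F v + ∑ i, mult i * c i v

/-- Linear independence constraint qualification: the derivatives of the active constraints are
linearly independent. -/
def LICQ (c : ι → V → ℝ) (v : V) : Prop :=
  LinearIndependent ℝ (fun i : {i : ι // c i v = 0} => fderiv ℝ (c i) v)

/-- `mult` is a Lagrange (Karush-Kuhn-Tucker) multiplier at the point `v`. -/
structure IsKKT (F : V → ℝ) (c : ι → V → ℝ) (E : Set ι) (v : V) (mult : ι → ℝ) : Prop where
  feasible : v ∈ feasibleSet c E
  stationary : fderiv ℝ (lagrangian F c mult) v = 0
  nonneg : ∀ i, i ∉ E → 0 ≤ mult i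
  complementary : ∀ i, mult i * c i v = 0

/-- The critical cone at a KKT point. -/
def criticalCone (c : ι → V → ℝ) (E : Set ι) (v : V) (mult : ι → ℝ) : Set V :=
  {d | (∀ i ∈ E, fderiv ℝ (c i) v d = 0) ∧
    ∀ i, i ∉ E → c i v = 0 →
      fderiv ℝ (c i) v d ≤ 0 ∧ (0 < mult i → fderiv ℝ (c i) v d = 0)}

/-- Second order sufficient optimality conditions: the pair is a KKT pair and the Hessian of the
Lagrangian is positive on the nonzero critical directions. -/
def SSOC (F : V → ℝ) (c : ι → V → ℝ) (E : Set ι) (v : V) (mult : ι → ℝ) : Prop :=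
  IsKKT F c E v mult ∧
    ∀ d ∈ criticalCone c E v mult, d ≠ 0 →
      0 < fderiv ℝ (fderiv ℝ (lagrangian F c mult)) v d d

/-- Strict complementarity: active inequality constraints have positive multipliers. -/
def StrictComplementarity (c : ι → V → ℝ) (E : Set ι) (v : V) (mult : ι → ℝ) : Prop :=
  ∀ i, i ∉ E → c i v = 0 → 0 < mult i

end NLP

/-! ### Control systems with stage costs and constraints -/

/-- Data of the control problem: the dynamics `x⁺ = f x u w`, the stage cost, and a description of
the state and control constraint sets by finitely many equalities and inequalities. -/
structure ControlProblem (X U W : Type*) where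
  /-- the dynamics -/
  f : X → U → W → X
  /-- the stage cost -/
  stageCost : X → U → W → ℝ
  /-- number of state constraints -/
  nX : ℕ
  /-- state constraint functions -/
  gX : Fin nX → X → ℝ
  /-- those state constraints which are equalities -/
  eqX : Set (Fin nX)
  /-- number of control constraints -/
  nU : ℕ
  /-- control constraint functions -/
  gU : Fin nU → U → ℝ
  /-- those control constraints which are equalities -/
  eqU : Set (Fin nU)

namespace ControlProblem

variable {X U W : Type*} (P : ControlProblem X U W) {N : ℕ}

/-- The state constraint set. -/
def stateSet : Set X := feasibleSet P.gX P.eqX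

/-- The control constraint set. -/
def controlSet : Set U := feasibleSet P.gU P.eqU

/-- The trajectory `x(0), …, x(N+1)` with `x(0) = x₀` and `x(k+1) = f (x(k)) (u(k)) (w(k))`. -/
def traj (x₀ : X) (u : Fin (N + 1) → U) (w : Fin (N + 1) → W) : Fin (N + 2) → X :=
  Fin.induction (motive := fun _ => X) x₀ (fun k xk => P.f xk (u k) (w k))

/-- The set of admissible control sequences `u(0), …, u(N)` for the initial value `x` and the
disturbance sequence `w`. -/
def admissible (x : X) (w : Fin (N + 1) → W) : Set (Fin (N + 1) → U) :=
  {u | ∀ k : Fin (N + 1),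
    P.f (P.traj x u w k.castSucc) (u k) (w k) ∈ P.stateSet ∧ u k ∈ P.controlSet}

/-- The finite horizon cost `∑_{k=0}^{N} ℓ(x(k), u(k), w(k))`. -/
def cost (x : X) (u : Fin (N + 1) → U) (w : Fin (N + 1) → W) : ℝ :=
  ∑ k : Fin (N + 1), P.stageCost (P.traj x u w k.castSucc) (u k) (w k)

/-- The control sequence `u` minimises the cost over all admissible control sequences. -/
def IsOptimal (x : X) (w : Fin (N + 1) → W) (u : Fin (N + 1) → U) : Prop :=
  u ∈ P.admissible x w ∧ IsMinOn (fun u' => P.cost x u' w) (P.admissible x w) u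

/-- The control sequence `u` is admissible and a local minimiser of the cost over the admissible
control sequences. -/
def IsLocallyOptimal [TopologicalSpace U] (x : X) (w : Fin (N + 1) → W) (u : Fin (N + 1) → U) :
    Prop :=
  u ∈ P.admissible x w ∧ IsLocalMinOn (fun u' => P.cost x u' w) (P.admissible x w) u

/-- The constraints of the open loop problem as functions of the control sequence: the state
constraints at the times `1, …, N+1` and the control constraints at the times `0, …, N`. -/
def constraint (x : X) (w : Fin (N + 1) → W) :
    (Fin P.nX × Fin (N + 1)) ⊕ (Fin P.nU × Fin (N + 1)) → (Fin (N + 1) → U) → ℝ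
  | Sum.inl (i, k), u => P.gX i (P.f (P.traj x u w k.castSucc) (u k) (w k))
  | Sum.inr (j, k), u => P.gU j (u k)

/-- The equality constraints among the constraints of the open loop problem. -/
def eqIndices (N : ℕ) : Set ((Fin P.nX × Fin (N + 1)) ⊕ (Fin P.nU × Fin (N + 1))) :=
  {a | Sum.elim (fun p => p.1 ∈ P.eqX) (fun p => p.1 ∈ P.eqU) a}

/-- Consistency of the two descriptions: the admissible control sequences are exactly the feasible
points of the constraint system `constraint`. -/
theorem admissible_eq_feasibleSet (x : X) (w : Fin (N + 1) → W) :
    P.admissible x w = feasibleSet (P.constraint x w) (P.eqIndices N) := by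
  ext u
  constructor
  · rintro h (⟨i, k⟩ | ⟨j, k⟩)
    · exact (h k).1 i
    · exact (h k).2 j
  · intro h k
    exact ⟨fun i => h (Sum.inl (i, k)), fun j => h (Sum.inr (j, k))⟩

end ControlProblem

variable {X U W : Type*}
  [NormedAddCommGroup X] [NormedSpace ℝ X] [NormedAddCommGroup U] [NormedSpace ℝ U]
  [NormedAddCommGroup W] [NormedSpace ℝ W] {N : ℕ}

/-- The hypotheses of the parametric sensitivity theorem at the nominal data `(x, w)` and the
nominal control sequence `u`: the dynamics, the stage cost and the constraint functions are twice
continuously differentiable in a neighbourhood of the nominal solution (`ContDiffAt ℝ 2`), and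
LICQ, SSOC and strict complementarity hold. -/
structure SensitivityConditions (P : ControlProblem X U W)
    (x : X) (w : Fin (N + 1) → W) (u : Fin (N + 1) → U) : Prop where
  smooth_f : ∀ k : Fin (N + 1),
    ContDiffAt ℝ 2 (fun q : X × U × W => P.f q.1 q.2.1 q.2.2) (P.traj x u w k.castSucc, u k, w k)
  smooth_stageCost : ∀ k : Fin (N + 1),
    ContDiffAt ℝ 2 (fun q : X × U × W => P.stageCost q.1 q.2.1 q.2.2)
      (P.traj x u w k.castSucc, u k, w k)
  smooth_gX : ∀ (i : Fin P.nX) (k : Fin (N + 1)), ContDiffAt ℝ 2 (P.gX i) (P.traj x u w k.succ)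
  smooth_gU : ∀ (j : Fin P.nU) (k : Fin (N + 1)), ContDiffAt ℝ 2 (P.gU j) (u k)
  licq : LICQ (P.constraint x w) u
  ssoc_scc : ∃ mult,
    SSOC (fun u' => P.cost x u' w) (P.constraint x w) (P.eqIndices N) u mult ∧
      StrictComplementarity (P.constraint x w) (P.eqIndices N) u mult

/-- `S = (∂u⋆/∂x, ∂u⋆/∂w)` at the nominal data `(x, w)` with nominal control sequence `u`: the
derivative at `(x, w)` of a map that assigns to every `(x', w')` near `(x, w)` a local minimiser of
the open loop problem with data `(x', w')` and that passes through `u` at `(x, w)`. -/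
def IsSensitivity (P : ControlProblem X U W) (x : X) (w : Fin (N + 1) → W)
    (u : Fin (N + 1) → U) (S : X × (Fin (N + 1) → W) →L[ℝ] (Fin (N + 1) → U)) : Prop :=
  ∃ v : X × (Fin (N + 1) → W) → (Fin (N + 1) → U),
    v (x, w) = u ∧
    (∀ᶠ p in 𝓝 (x, w), P.IsLocallyOptimal p.1 p.2 (v p)) ∧
    HasFDerivAt v S (x, w)

/-- The sensitivity-updated control sequence
`ū(·, x̄, w̄) = u⋆(·, x, w) + ∂u⋆/∂x (x̄ - x) + ∂u⋆/∂w (w̄ - w)`. -/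
def updatedControl (ustar : X → (Fin (N + 1) → W) → (Fin (N + 1) → U))
    (S : X → (Fin (N + 1) → W) → (X × (Fin (N + 1) → W) →L[ℝ] (Fin (N + 1) → U)))
    (xbar x : X) (wbar w : Fin (N + 1) → W) : Fin (N + 1) → U :=
  ustar x w + S x w (xbar - x, wbar - w)

/-- The tuples `(x̄, x, w̄, w)` of disturbed and nominal data with states in `A` and disturbances in
`Wset` that satisfy the bounds on the state deviation, on the disturbance deviation, and on the
change of the disturbance from one time instant to the next. -/
structure IsTuple (A : Set X) (Wset : Set W) (Δx Δw : ℝ)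
    (xbar x : X) (wbar w : Fin (N + 1) → W) : Prop where
  xbar_mem : xbar ∈ A
  x_mem : x ∈ A
  wbar_mem : ∀ k, wbar k ∈ Wset
  w_mem : ∀ k, w k ∈ Wset
  state_bound : dist xbar x ≤ Δx
  disturbance_bound : ∀ k, dist (wbar k) (w k) ≤ Δw
  change_bound : ∀ k : Fin N, dist (wbar k.succ) (wbar k.castSucc) ≤ Δw

/-- The nominal data `(x, w)` that occur in some tuple `(x̄, x, w̄, w)`. -/
def nominalPairs (N : ℕ) (A : Set X) (Wset : Set W) (Δx Δw : ℝ) :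
    Set (X × (Fin (N + 1) → W)) :=
  {p | ∃ xbar wbar, IsTuple A Wset Δx Δw xbar p.1 wbar p.2}

/-- The Lipschitz assumption on the set `A`, for the feedback `μ(x, w) = u⋆(0, x, w)` and the
updated feedback `μ̄(x̄, w̄) = ū(0, x̄, w̄)`: the stage cost and the open loop cost change at most by
`Lℓ` and `LJ` times the size of the disturbance, with constants that serve all tuples. The distance
of two disturbance sequences is the maximum over the time instants. -/
def LipschitzAssumption (P : ControlProblem X U W) (Wset : Set W) (Δx Δw : ℝ) (xstar : X)
    (ustar : X → (Fin (N + 1) → W) → (Fin (N + 1) → U))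
    (S : X → (Fin (N + 1) → W) → (X × (Fin (N + 1) → W) →L[ℝ] (Fin (N + 1) → U)))
    (A : Set X) : Prop :=
  xstar ∈ A ∧ A ⊆ P.stateSet ∧
    ∃ Lℓ LJ : ℝ, 0 ≤ Lℓ ∧ 0 ≤ LJ ∧
      ∀ (xbar x : X) (wbar w : Fin (N + 1) → W), IsTuple A Wset Δx Δw xbar x wbar w →
        |P.stageCost xbar (updatedControl ustar S xbar x wbar w 0) (wbar 0)
            - P.stageCost x (ustar x w 0) (w 0)| ≤ Lℓ * (dist xbar x + dist wbar w) ∧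
        |P.cost xbar (updatedControl ustar S xbar x wbar w) wbar
            - P.cost x (ustar x w) w| ≤ LJ * (dist xbar x + dist wbar w)

end MPC

namespace MPC

open Filter

/-! ### Calculus and linear algebra: second derivatives, coercivity, local coordinates -/

section Auxiliary

/-! The core is a parametric sensitivity theorem with parameters in a Banach space,
`exists_local_solution`. By LICQ the active constraints `y`, completed by free variables `z`, are
local coordinates on the control space, and these depend in a C² way on the parameter. In them the
feasible set is locally a fixed `orthant`, independent of the parameter. At the nominal parameter
the cost is the Lagrangian minus the linear form in `y` whose coefficients are the multipliers.
Hence strict complementarity makes the cost strictly decreasing in every inequality coordinate,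
which forces `y = 0` at nearby minimisers, and the second order condition makes its Hessian in `z`
positive definite. The implicit function theorem for `∂G/∂z (p, 0, z) = 0` then yields a C¹ branch
of local minimisers that contains every local solution nearby.

Local uniqueness identifies each sensitivity with the derivative of this branch. Since `ustar` is
continuous and optimal on the nominal data, it lies on the branch there, so `S` is continuous
(`continuousOn_sensitivity`).

The tuples over `K` form a compact set, so it suffices to bound the change of cost linearly near
each tuple (`exists_lipschitz_update`). Where disturbed and nominal data differ, continuity is
enough. Where they coincide, the cost is locally Lipschitz and `S` is locally bounded. -/

theorem fderiv_fderiv_comp {E F : Type*} [NormedAddCommGroup E] [NormedSpace ℝ E]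
    [NormedAddCommGroup F] [NormedSpace ℝ F] {L : F → ℝ} {φ : E → F} {s : E}
    (hL : ContDiffAt ℝ 2 L (φ s)) (hφ : ContDiffAt ℝ 2 φ s) (a b : E) :
    fderiv ℝ (fderiv ℝ (fun t => L (φ t))) s a b =
      fderiv ℝ (fderiv ℝ L) (φ s) (fderiv ℝ φ s a) (fderiv ℝ φ s b) +
        fderiv ℝ L (φ s) (fderiv ℝ (fderiv ℝ φ) s a b) := by
  have hφ1 : ∀ᶠ t in 𝓝 s, ContDiffAt ℝ 2 φ t := hφ.eventually (by simp)
  have hL1 : ∀ᶠ t in 𝓝 s, ContDiffAt ℝ 2 L (φ t) :=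
    hφ.continuousAt.eventually (hL.eventually (by simp))
  have heq : fderiv ℝ (fun t => L (φ t)) =ᶠ[𝓝 s]
      fun t => (fderiv ℝ L (φ t)).comp (fderiv ℝ φ t) := by
    filter_upwards [hφ1, hL1] with t h1 h2
    exact fderiv_comp t (h2.differentiableAt (by simp)) (h1.differentiableAt (by simp))
  have hdφ : HasFDerivAt (fderiv ℝ φ) (fderiv ℝ (fderiv ℝ φ) s) s :=
    ((hφ.fderiv_right (m := 1) (by norm_num)).differentiableAt (by simp)).hasFDerivAt
  have hdL : HasFDerivAt (fderiv ℝ L) (fderiv ℝ (fderiv ℝ L) (φ s)) (φ s) :=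
    ((hL.fderiv_right (m := 1) (by norm_num)).differentiableAt (by simp)).hasFDerivAt
  have hφ' : HasFDerivAt φ (fderiv ℝ φ s) s := (hφ.differentiableAt (by simp)).hasFDerivAt
  have := (hdL.comp s hφ').clm_comp hdφ
  rw [heq.fderiv_eq]
  erw [this.fderiv]
  simp [add_comm]

/-- A positive definite bilinear form on a finite-dimensional space is coercive. -/
theorem exists_coercive_of_pos {Z : Type*} [NormedAddCommGroup Z] [NormedSpace ℝ Z]
    [FiniteDimensional ℝ Z] (B : Z →L[ℝ] Z →L[ℝ] ℝ) (hB : ∀ z, z ≠ 0 → 0 < B z z) :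
    ∃ α > 0, ∀ z, α * ‖z‖ ^ 2 ≤ B z z := by
  have hcomp : IsCompact (Metric.sphere (0 : Z) 1) := isCompact_sphere 0 1
  rcases (Metric.sphere (0 : Z) 1).eq_empty_or_nonempty with he | hne
  · refine ⟨1, one_pos, fun z => ?_⟩
    have : z = 0 := by
      by_contra hz
      have : ‖z‖⁻¹ • z ∈ Metric.sphere (0 : Z) 1 := by simp [norm_smul, hz]
      simp [he] at this
    simp [this]
  · obtain ⟨z0, hz0, hmin⟩ := hcomp.exists_isMinOn hne
      (f := fun z => B z z) (by fun_prop)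
    have hz0' : z0 ≠ 0 := by rintro rfl; simp at hz0
    refine ⟨B z0 z0, hB z0 hz0', fun z => ?_⟩
    by_cases hz : z = 0
    · simp [hz]
    have h1 : ‖z‖⁻¹ • z ∈ Metric.sphere (0 : Z) 1 := by simp [norm_smul, hz]
    have h2 : B z0 z0 ≤ B (‖z‖⁻¹ • z) (‖z‖⁻¹ • z) := hmin h1
    have hn : 0 < ‖z‖ := norm_pos_iff.2 hz
    simp only [map_smul, smul_apply, smul_eq_mul] at h2
    calc B z0 z0 * ‖z‖ ^ 2 ≤ (‖z‖⁻¹ * (‖z‖⁻¹ * B z z)) * ‖z‖ ^ 2 := by gcongr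
      _ = B z z := by field_simp

theorem isInvertible_of_bijective {V S : Type*} [NormedAddCommGroup V] [NormedSpace ℝ V]
    [FiniteDimensional ℝ V] [NormedAddCommGroup S] [NormedSpace ℝ S]
    (T : V →L[ℝ] S) (hT : Function.Bijective T) : T.IsInvertible :=
  ⟨(LinearEquiv.ofBijective T.toLinearMap hT).toContinuousLinearEquiv, by ext; rfl⟩

theorem isInvertible_of_pos {Z : Type*} [NormedAddCommGroup Z] [NormedSpace ℝ Z]
    [FiniteDimensional ℝ Z] (B : Z →L[ℝ] Z →L[ℝ] ℝ) (hB : ∀ z, z ≠ 0 → 0 < B z z) :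
    B.IsInvertible := by
  have hinj : Function.Injective B := by
    rw [injective_iff_map_eq_zero]
    intro z hz
    by_contra h
    simpa [hz] using hB z h
  apply isInvertible_of_bijective
  have hfr : Module.finrank ℝ Z = Module.finrank ℝ (Z →L[ℝ] ℝ) := by
    rw [← (LinearMap.toContinuousLinearMap (𝕜 := ℝ) (E := Z) (F' := ℝ)).finrank_eq]
    exact (Subspace.dual_finrank_eq (K := ℝ) (V := Z)).symm
  exact ⟨hinj, (LinearMap.injective_iff_surjective_of_finrank_eq_finrank hfr
    (f := B.toLinearMap)).1 hinj⟩

/-- An inverse function theorem in `v` with `p` as passive parameter: the implicit function theorem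
is applied to `ψ (p, v) - s = 0`, with `(p, s)` as the parameter and `v` as the unknown. -/
theorem exists_local_coordinates {Θ V S : Type*}
    [NormedAddCommGroup Θ] [NormedSpace ℝ Θ] [CompleteSpace Θ]
    [NormedAddCommGroup V] [NormedSpace ℝ V] [CompleteSpace V]
    [NormedAddCommGroup S] [NormedSpace ℝ S] [CompleteSpace S]
    {ψ : Θ × V → S} {a : Θ × V} (hψ : ContDiffAt ℝ 2 ψ a)
    (hinv : (fderiv ℝ ψ a ∘L ContinuousLinearMap.inr ℝ Θ V).IsInvertible) :
    ∃ φ : Θ × S → V, φ (a.1, ψ a) = a.2 ∧ ContDiffAt ℝ 2 φ (a.1, ψ a) ∧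
      (∀ᶠ q in 𝓝 (a.1, ψ a), ψ (q.1, φ q) = q.2) ∧
      ∀ᶠ q in 𝓝 a, φ (q.1, ψ q) = q.2 := by
  set Ξ : (Θ × S) × V → S := fun q => ψ (q.1.1, q.2) - q.1.2 with hΞdef
  set u : (Θ × S) × V := ((a.1, ψ a), a.2) with hu
  have hψ' : ContDiffAt ℝ 2 (fun q : (Θ × S) × V => ψ (q.1.1, q.2)) u :=
    ContDiffAt.comp u (g := ψ) (f := fun q : (Θ × S) × V => (q.1.1, q.2)) hψ (by fun_prop)
  have hΞ : ContDiffAt ℝ 2 Ξ u := hψ'.sub (by fun_prop)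
  have hΞu : Ξ u = 0 := by simp [hΞdef, hu]
  have hd : fderiv ℝ Ξ u ∘L ContinuousLinearMap.inr ℝ (Θ × S) V =
      fderiv ℝ ψ a ∘L ContinuousLinearMap.inr ℝ Θ V := by
    have h1 : HasFDerivAt (fun v : V => Ξ ((a.1, ψ a), v))
        (fderiv ℝ Ξ u ∘L ContinuousLinearMap.inr ℝ (Θ × S) V) a.2 :=
      (hΞ.differentiableAt (by simp)).hasFDerivAt.comp a.2 (hasFDerivAt_prodMk_right _ _)
    have h2 : HasFDerivAt (fun v : V => ψ (a.1, v) - ψ a)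
        (fderiv ℝ ψ a ∘L ContinuousLinearMap.inr ℝ Θ V) a.2 :=
      ((hψ.differentiableAt (by simp)).hasFDerivAt.comp a.2
        (hasFDerivAt_prodMk_right _ _)).sub_const _
    exact h1.unique h2
  have hinv' : (fderiv ℝ Ξ u ∘L ContinuousLinearMap.inr ℝ (Θ × S) V).IsInvertible := by
    rwa [hd]
  refine ⟨hΞ.implicitFunction (by simp) hinv', hΞ.implicitFunction_apply_self (by simp) hinv',
    hΞ.contDiffAt_implicitFunction (by simp) hinv', ?_, ?_⟩
  · filter_upwards [hΞ.eventually_apply_implicitFunction (by simp) hinv'] with q hq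
    rw [hΞu] at hq
    exact sub_eq_zero.1 hq
  · have hc : ContinuousAt (fun q : Θ × V => ((q.1, ψ q), q.2)) a :=
      (continuousAt_fst.prodMk hψ.continuousAt).prodMk continuousAt_snd
    filter_upwards [hc.eventually
      (hΞ.eventually_apply_eq_iff_implicitFunction (by simp) hinv')] with q hq
    exact hq.1 (by rw [hΞu]; simp [hΞdef])

end Auxiliary

/-! ### First order conditions on an orthant and monotonicity in the free variables -/

section Orthant

/-- The points `(y, z)` with `y ≤ 0` and `y i = 0` for `i ∈ E`. -/
def orthant {κ : Type*} (Z : Type*) (E : Set κ) : Set ((κ → ℝ) × Z) :=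
  feasibleSet (fun i s => s.1 i) E

variable {Θ Z κ : Type*}
    [NormedAddCommGroup Θ] [NormedSpace ℝ Θ] [NormedAddCommGroup Z] [NormedSpace ℝ Z] [Fintype κ]

theorem zero_mem_orthant (E : Set κ) (z : Z) : ((0, z) : (κ → ℝ) × Z) ∈ orthant Z E :=
  fun _ => ⟨le_rfl, fun _ => rfl⟩

/-- At a local minimiser on `C`, the derivative vanishes in every direction along which a two-sided
line segment stays in `C`. -/
theorem fderiv_apply_eq_zero_of_isLocalMin_line {E : Type*} [NormedAddCommGroup E]
    [NormedSpace ℝ E] {g : E → ℝ} {C : Set E} {s d : E} (hg : DifferentiableAt ℝ g s)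
    (hmin : IsLocalMinOn g C s) (hC : ∀ᶠ t : ℝ in 𝓝 0, s + t • d ∈ C) : fderiv ℝ g s d = 0 := by
  have hline : Tendsto (fun t : ℝ => s + t • d) (𝓝 0) (𝓝[C] s) := by
    refine tendsto_nhdsWithin_iff.2 ⟨?_, hC⟩
    have : Continuous fun t : ℝ => s + t • d := by fun_prop
    simpa using this.tendsto 0
  have hloc : IsLocalMin (fun t : ℝ => g (s + t • d)) 0 := by
    have := hline.eventually hmin
    filter_upwards [this] with t ht
    simpa using ht
  have hder : HasDerivAt (fun t : ℝ => g (s + t • d)) (fderiv ℝ g s d) 0 := by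
    have h1 : HasDerivAt (fun t : ℝ => s + t • d) d 0 := by
      simpa using ((hasDerivAt_id (0 : ℝ)).smul_const d).const_add s
    have h2 : HasFDerivAt g (fderiv ℝ g s) (s + (0 : ℝ) • d) := by
      simpa using hg.hasFDerivAt
    exact h2.comp_hasDerivAt 0 h1
  exact hloc.hasDerivAt_eq_zero hder

theorem le_of_fderiv_nonneg_segment {E : Type*} [NormedAddCommGroup E]
    [NormedSpace ℝ E] {g : E → ℝ} {a b : E}
    (hg : ∀ ξ ∈ segment ℝ a b, DifferentiableAt ℝ g ξ)
    (h : ∀ ξ ∈ segment ℝ a b, 0 ≤ fderiv ℝ g ξ (b - a)) : g a ≤ g b := by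
  obtain ⟨ξ, hξ, he⟩ := domain_mvt (f := g) (f' := fun ξ => fderiv ℝ g ξ)
    (fun x hx => (hg x hx).hasFDerivAt.hasFDerivWithinAt) (convex_segment a b)
    (left_mem_segment ℝ a b) (right_mem_segment ℝ a b)
  have := h ξ hξ
  linarith

/-- The partial derivative of `G` with respect to the free variable `z` at `y = 0`. -/
noncomputable def freeDeriv (G : Θ × ((κ → ℝ) × Z) → ℝ) (q : Θ × Z) : Z →L[ℝ] ℝ :=
  (fderiv ℝ G (q.1, (0, q.2))).comp
    ((ContinuousLinearMap.inr ℝ Θ ((κ → ℝ) × Z)).comp (ContinuousLinearMap.inr ℝ (κ → ℝ) Z))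

theorem freeDeriv_apply (G : Θ × ((κ → ℝ) × Z) → ℝ) (q : Θ × Z) (z : Z) :
    freeDeriv G q z = fderiv ℝ G (q.1, (0, q.2)) (0, (0, z)) := rfl

theorem fderiv_slice {V : Type*} [NormedAddCommGroup V] [NormedSpace ℝ V] {G : Θ × V → ℝ} {p : Θ}
    {s : V} (hG : DifferentiableAt ℝ G (p, s)) (d : V) :
    fderiv ℝ (fun s => G (p, s)) s d = fderiv ℝ G (p, s) (0, d) := by
  have := hG.hasFDerivAt.comp s (hasFDerivAt_prodMk_right p s)
  exact congrArg (fun T : V →L[ℝ] ℝ => T d) this.fderiv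

theorem fderiv_fderiv_slice {V : Type*} [NormedAddCommGroup V] [NormedSpace ℝ V] {G : Θ × V → ℝ}
    {p : Θ} {s : V} (hG : ContDiffAt ℝ 2 G (p, s)) (a b : V) :
    fderiv ℝ (fderiv ℝ (fun s => G (p, s))) s a b
      = fderiv ℝ (fderiv ℝ G) (p, s) (0, a) (0, b) := by
  rw [fderiv_fderiv_comp (φ := fun s => (p, s)) hG (by fun_prop)]
  have h1 : fderiv ℝ (fun s : V => (p, s)) = fun _ => ContinuousLinearMap.inr ℝ Θ V := by
    ext1 t
    exact (hasFDerivAt_prodMk_right p t).fderiv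
  simp [h1]

theorem contDiffAt_freeDeriv {G : Θ × ((κ → ℝ) × Z) → ℝ} {p : Θ} {z : Z}
    (hG : ContDiffAt ℝ 2 G (p, (0, z))) : ContDiffAt ℝ 1 (freeDeriv G) (p, z) := by
  have h1 : ContDiffAt ℝ 1 (fderiv ℝ G) (p, (0, z)) := hG.fderiv_right (by norm_num)
  have h2 : ContDiffAt ℝ 1 (fun q : Θ × Z => fderiv ℝ G (q.1, (0, q.2))) (p, z) :=
    ContDiffAt.comp (p, z) (g := fderiv ℝ G) (f := fun q : Θ × Z => (q.1, ((0 : κ → ℝ), q.2))) h1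
      (by fun_prop)
  exact h2.clm_comp contDiffAt_const

theorem fderiv_freeDeriv {G : Θ × ((κ → ℝ) × Z) → ℝ} {p : Θ} {z : Z}
    (hG : ContDiffAt ℝ 2 G (p, (0, z))) (a b : Z) :
    fderiv ℝ (freeDeriv G) (p, z) (0, a) b =
      fderiv ℝ (fderiv ℝ G) (p, (0, z)) (0, (0, a)) (0, (0, b)) := by
  have h1 : HasFDerivAt (fderiv ℝ G) (fderiv ℝ (fderiv ℝ G) (p, (0, z))) (p, (0, z)) :=
    ((hG.fderiv_right (m := 1) (by norm_num)).differentiableAt (by simp)).hasFDerivAt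
  have h2 : HasFDerivAt (fun q : Θ × Z => (q.1, ((0 : κ → ℝ), q.2)))
      ((ContinuousLinearMap.fst ℝ Θ Z).prod
        ((0 : Θ × Z →L[ℝ] (κ → ℝ)).prod (ContinuousLinearMap.snd ℝ Θ Z))) (p, z) :=
    hasFDerivAt_fst.prodMk ((hasFDerivAt_const _ _).prodMk hasFDerivAt_snd)
  have h3 := (h1.comp (p, z) h2).clm_comp (hasFDerivAt_const
    ((ContinuousLinearMap.inr ℝ Θ ((κ → ℝ) × Z)).comp (ContinuousLinearMap.inr ℝ (κ → ℝ) Z)) (p, z))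
  have h4 : HasFDerivAt (freeDeriv G) _ (p, z) := h3
  rw [h4.fderiv]
  simp

/-- Near a point where `freeDeriv G` has a positive definite derivative in `z`, it is strictly
monotone in `z`. -/
theorem exists_monotone_freeDeriv [FiniteDimensional ℝ Z] {G : Θ × ((κ → ℝ) × Z) → ℝ}
    {p : Θ} {z : Z} (hG : ContDiffAt ℝ 2 G (p, (0, z)))
    (hpos : ∀ a, a ≠ 0 → 0 < fderiv ℝ (freeDeriv G) (p, z) (0, a) a) :
    ∃ α > 0, ∃ δ > 0, ∀ p' z₁ z₂, dist p' p < δ → dist z₁ z < δ → dist z₂ z < δ →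
      α * ‖z₁ - z₂‖ ^ 2 ≤ (freeDeriv G (p', z₁) - freeDeriv G (p', z₂)) (z₁ - z₂) := by
  set B : Z →L[ℝ] Z →L[ℝ] ℝ :=
    (fderiv ℝ (freeDeriv G) (p, z)).comp (ContinuousLinearMap.inr ℝ Θ Z) with hB
  obtain ⟨α, hα, hco⟩ := exists_coercive_of_pos B hpos
  have hs := (contDiffAt_freeDeriv hG).hasStrictFDerivAt (by simp)
  -- Strict differentiability bounds the linearisation error by half the coercivity constant, so the
  -- other half remains as the monotonicity constant.
  have := (hasStrictFDerivAt_iff_isLittleO.1 hs).def (half_pos hα)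
  obtain ⟨δ, hδ, hball⟩ := Metric.eventually_nhds_iff.1 this
  refine ⟨α / 2, half_pos hα, δ, hδ, fun p' z₁ z₂ hp h₁ h₂ => ?_⟩
  have hb := hball (y := ((p', z₁), (p', z₂)))
    (by simp only [Prod.dist_eq, max_lt_iff]; exact ⟨⟨hp, h₁⟩, ⟨hp, h₂⟩⟩)
  have he : ((p', z₁) : Θ × Z) - (p', z₂) = (0, z₁ - z₂) := by simp
  have hn : ‖((0 : Θ), z₁ - z₂)‖ = ‖z₁ - z₂‖ := by simp [Prod.norm_def]
  simp only [he, hn] at hb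
  set d := z₁ - z₂
  set R := freeDeriv G (p', z₁) - freeDeriv G (p', z₂) - fderiv ℝ (freeDeriv G) (p, z) (0, d)
  have h1 : |R d| ≤ α / 2 * ‖d‖ * ‖d‖ :=
    (R.le_opNorm d).trans (mul_le_mul_of_nonneg_right hb (norm_nonneg _))
  have h2 : α * ‖d‖ ^ 2 ≤ fderiv ℝ (freeDeriv G) (p, z) (0, d) d := hco d
  have h3 : R d = (freeDeriv G (p', z₁) - freeDeriv G (p', z₂)) d
      - fderiv ℝ (freeDeriv G) (p, z) (0, d) d := rfl
  have h4 := (abs_le.1 h1).1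
  nlinarith

end Orthant

/-! ### Solution branch for problems on an orthant -/

section OrthantSolution

variable {Θ Z κ : Type*}
    [NormedAddCommGroup Θ] [NormedSpace ℝ Θ] [NormedAddCommGroup Z] [NormedSpace ℝ Z] [Fintype κ]
    [DecidableEq κ]

/-- A local minimiser on the orthant at which the cost strictly decreases in the directions of the
inequality coordinates has all these coordinates at their bounds. -/
theorem fst_eq_zero_of_isLocalMinOn_orthant {g : (κ → ℝ) × Z → ℝ} {E : Set κ} {s : (κ → ℝ) × Z}
    (hg : DifferentiableAt ℝ g s) (hneg : ∀ i, i ∉ E → fderiv ℝ g s (Pi.single i 1, 0) < 0)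
    (hs : s ∈ orthant Z E) (hmin : IsLocalMinOn g (orthant Z E) s) : s.1 = 0 := by
  funext i
  by_cases hi : i ∈ E
  · exact (hs i).2 hi
  refine le_antisymm (hs i).1 (not_lt.1 fun hlt => ?_)
  have hC : ∀ᶠ t : ℝ in 𝓝 0, s + t • ((Pi.single i 1, 0) : (κ → ℝ) × Z) ∈ orthant Z E := by
    have : ∀ᶠ t : ℝ in 𝓝 0, t < - s.1 i := eventually_lt_nhds (by simpa using hlt)
    filter_upwards [this] with t ht j
    by_cases hj : j = i
    · subst hj
      refine ⟨?_, fun h => absurd h hi⟩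
      simp
      linarith
    · simpa [Pi.single_eq_of_ne hj] using hs j
  exact (hneg i hi).ne (fderiv_apply_eq_zero_of_isLocalMin_line hg hmin hC)

/-- On the orthant, the value at `(y, z)` is at least the value at `(0, z)` if the cost strictly
decreases in the directions of the inequality coordinates. -/
theorem apply_zero_le_of_mem_orthant {g : (κ → ℝ) × Z → ℝ} {E : Set κ} {y : κ → ℝ} {z : Z}
    (hs : (y, z) ∈ orthant Z E)
    (hg : ∀ ξ ∈ segment ℝ (0, z) (y, z), DifferentiableAt ℝ g ξ ∧
      ∀ i, i ∉ E → fderiv ℝ g ξ (Pi.single i 1, 0) < 0) : g (0, z) ≤ g (y, z) := by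
  refine le_of_fderiv_nonneg_segment (fun ξ hξ => (hg ξ hξ).1) fun ξ hξ => ?_
  have hsum : ((y, z) - (0, z) : (κ → ℝ) × Z) = ∑ i, y i • ((Pi.single i 1, 0) : (κ → ℝ) × Z) := by
    ext j
    · simp [Prod.fst_sum, Finset.sum_apply, Pi.single_apply]
    · simp [Prod.snd_sum]
  rw [hsum, map_sum]
  refine Finset.sum_nonneg fun i _ => ?_
  rw [map_smul, smul_eq_mul]
  by_cases hi : i ∈ E
  · have : y i = 0 := (hs i).2 hi
    simp [this]
  · exact mul_nonneg_of_nonpos_of_nonpos (hs i).1 ((hg ξ hξ).2 i hi).le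

/-- Critical points of functions with a monotone derivative are minimisers. -/
theorem apply_le_of_monotone_fderiv {g : Z → ℝ} {a b : Z}
    (hg : ∀ ξ ∈ segment ℝ a b, DifferentiableAt ℝ g ξ)
    (ha : fderiv ℝ g a = 0)
    (hmono : ∀ ξ ∈ segment ℝ a b, 0 ≤ (fderiv ℝ g ξ - fderiv ℝ g a) (ξ - a)) : g a ≤ g b := by
  refine le_of_fderiv_nonneg_segment hg fun ξ hξ => ?_
  have h := hmono ξ hξ
  rw [ha, sub_zero] at h
  -- Here `ξ - a = t • (b - a)`, so the sign along `ξ - a` gives the sign along `b - a` after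
  -- division by `t`.
  obtain ⟨t, ⟨ht0, -⟩, rfl⟩ := (segment_eq_image' ℝ a b).subset hξ
  rcases ht0.eq_or_lt with rfl | ht
  · simp [ha]
  · simp only [add_sub_cancel_left, map_smul, smul_eq_mul] at h
    exact nonneg_of_mul_nonneg_right h ht

theorem hasFDerivAt_freeDeriv {G : Θ × ((κ → ℝ) × Z) → ℝ} {p : Θ} {z : Z}
    (hG : DifferentiableAt ℝ G (p, (0, z))) :
    HasFDerivAt (fun z => G (p, (0, z))) (freeDeriv G (p, z)) z :=
  hG.hasFDerivAt.comp z ((hasFDerivAt_prodMk_right p ((0 : κ → ℝ), z)).comp z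
    (hasFDerivAt_prodMk_right 0 z))

/-- Parametric sensitivity for problems on an orthant: strictly decreasing cost in the inequality
coordinates, and a nondegenerate critical point in the free coordinates. -/
theorem exists_local_solution_orthant [CompleteSpace Θ] [FiniteDimensional ℝ Z]
    {G : Θ × ((κ → ℝ) × Z) → ℝ} {E : Set κ} {p₀ : Θ} {z₀ : Z}
    (hG : ContDiffAt ℝ 2 G (p₀, (0, z₀)))
    (hneg : ∀ i, i ∉ E → fderiv ℝ (fun s => G (p₀, s)) (0, z₀) (Pi.single i 1, 0) < 0)
    (hcrit : ∀ z, fderiv ℝ (fun s => G (p₀, s)) (0, z₀) (0, z) = 0)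
    (hpos : ∀ z, z ≠ 0 →
      0 < fderiv ℝ (fderiv ℝ (fun s => G (p₀, s))) (0, z₀) (0, z) (0, z)) :
    ∃ ζ : Θ → Z, ζ p₀ = z₀ ∧ ContDiffAt ℝ 1 ζ p₀ ∧
      (∀ᶠ p in 𝓝 p₀, IsLocalMinOn (fun s => G (p, s)) (orthant Z E) (0, ζ p)) ∧
      ∀ᶠ q in 𝓝 (p₀, ((0 : κ → ℝ), z₀)), q.2 ∈ orthant Z E →
        IsLocalMinOn (fun s => G (q.1, s)) (orthant Z E) q.2 → q.2 = (0, ζ q.1) := by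
  have : CompleteSpace Z := FiniteDimensional.complete ℝ Z
  have hGd : DifferentiableAt ℝ G (p₀, (0, z₀)) := hG.differentiableAt (by simp)
  have hH := contDiffAt_freeDeriv hG
  have hpos' : ∀ a, a ≠ 0 → 0 < fderiv ℝ (freeDeriv G) (p₀, z₀) (0, a) a := by
    intro a ha
    rw [fderiv_freeDeriv hG, ← fderiv_fderiv_slice hG]
    exact hpos a ha
  have hH0 : freeDeriv G (p₀, z₀) = 0 := by
    ext z
    rw [freeDeriv_apply, ← fderiv_slice hGd]
    exact hcrit z
  have hinv : (fderiv ℝ (freeDeriv G) (p₀, z₀) ∘L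
      ContinuousLinearMap.inr ℝ Θ Z).IsInvertible := isInvertible_of_pos _ hpos'
  obtain ⟨α, hα, δ₁, hδ₁, hmono⟩ := exists_monotone_freeDeriv hG hpos'
  have hfd : ContinuousAt (fderiv ℝ G) (p₀, (0, z₀)) :=
    (hG.fderiv_right (m := 1) (by norm_num)).continuousAt
  have hnear : ∀ᶠ q in 𝓝 (p₀, ((0 : κ → ℝ), z₀)), DifferentiableAt ℝ G q ∧
      ∀ i, i ∉ E → fderiv ℝ G q (0, (Pi.single i 1, 0)) < 0 := by
    refine ((hG.eventually (by simp)).mono fun q hq => hq.differentiableAt (by simp)).and ?_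
    refine eventually_all.2 fun i => ?_
    by_cases hi : i ∈ E
    · simp [hi]
    have hc : ContinuousAt (fun q => fderiv ℝ G q (0, (Pi.single i 1, 0))) (p₀, ((0 : κ → ℝ), z₀)) :=
      hfd.clm_apply continuousAt_const
    have := hneg i hi
    rw [fderiv_slice hGd] at this
    exact (hc.eventually (eventually_lt_nhds this)).mono fun q hq _ => hq
  obtain ⟨δ₂, hδ₂, hnear⟩ := Metric.eventually_nhds_iff.1 hnear
  -- One radius for the monotonicity in `z` and for the signs of the derivatives in `y`. Balls are
  -- convex, so the segments used below stay inside.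
  set δ := min δ₁ δ₂ with hδdef
  have hδ : 0 < δ := lt_min hδ₁ hδ₂
  have hnear' : ∀ (p : Θ) (s : (κ → ℝ) × Z), dist p p₀ < δ → s ∈ Metric.ball (0, z₀) δ →
      DifferentiableAt ℝ (fun s => G (p, s)) s ∧ DifferentiableAt ℝ G (p, s) ∧
      ∀ i, i ∉ E → fderiv ℝ (fun s => G (p, s)) s (Pi.single i 1, 0) < 0 := by
    intro p s hp hs
    have h := hnear (y := (p, s)) (by
      rw [Prod.dist_eq, max_lt_iff]
      exact ⟨hp.trans_le (min_le_right _ _), (Metric.mem_ball.1 hs).trans_le (min_le_right _ _)⟩)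
    refine ⟨h.1.comp s ((hasFDerivAt_prodMk_right p s).differentiableAt), h.1, fun i hi => ?_⟩
    rw [fderiv_slice h.1]
    exact h.2 i hi
  have hmem0 : ∀ z, dist z z₀ < δ → ((0 : κ → ℝ), z) ∈ Metric.ball ((0 : κ → ℝ), z₀) δ := by
    intro z hz
    rw [Metric.mem_ball, Prod.dist_eq, max_lt_iff]
    exact ⟨by simpa using hδ, hz⟩
  set ζ := hH.implicitFunction (by simp) hinv with hζ
  have hζ0 : ζ p₀ = z₀ := hH.implicitFunction_apply_self (by simp) hinv
  have hζd : ContDiffAt ℝ 1 ζ p₀ := hH.contDiffAt_implicitFunction (by simp) hinv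
  have hζev : ∀ᶠ p in 𝓝 p₀, dist p p₀ < δ ∧ dist (ζ p) z₀ < δ ∧ freeDeriv G (p, ζ p) = 0 := by
    refine (Metric.eventually_nhds_iff.2 ⟨δ, hδ, fun _ h => h⟩).and (Eventually.and ?_ ?_)
    · have := hζd.continuousAt.eventually (Metric.ball_mem_nhds (ζ p₀) hδ)
      rwa [hζ0] at this
    · exact (hH.eventually_apply_implicitFunction (by simp) hinv).mono fun p hp => hp.trans hH0
  refine ⟨ζ, hζ0, hζd, ?_, ?_⟩
  · filter_upwards [hζev] with p ⟨hp, hζp, hcp⟩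
    have hball : ∀ᶠ s in 𝓝 ((0 : κ → ℝ), ζ p), s ∈ Metric.ball ((0 : κ → ℝ), z₀) δ :=
      Metric.isOpen_ball.mem_nhds (hmem0 _ hζp)
    refine eventually_nhdsWithin_iff.2 ?_
    filter_upwards [hball] with s hsb hsC
    obtain ⟨y, z⟩ := s
    have hz : dist z z₀ < δ := lt_of_le_of_lt (le_max_right _ _) hsb
    have hconv := convex_ball ((0 : κ → ℝ), z₀) δ
    -- The comparison passes through `(0, z)`: the inequality coordinates are first moved to their
    -- bounds, then `z` is moved to the critical point `ζ p`.
    have h1 : G (p, (0, z)) ≤ G (p, (y, z)) :=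
      apply_zero_le_of_mem_orthant (g := fun s => G (p, s)) hsC fun ξ hξ =>
        ⟨(hnear' p ξ hp (hconv.segment_subset (hmem0 z hz) hsb hξ)).1,
          (hnear' p ξ hp (hconv.segment_subset (hmem0 z hz) hsb hξ)).2.2⟩
    have hder : ∀ ξ, dist ξ z₀ < δ → HasFDerivAt (fun z => G (p, (0, z))) (freeDeriv G (p, ξ)) ξ :=
      fun ξ hξ => hasFDerivAt_freeDeriv (hnear' p (0, ξ) hp (hmem0 ξ hξ)).2.1
    have hseg : ∀ ξ ∈ segment ℝ (ζ p) z, dist ξ z₀ < δ := fun ξ hξ =>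
      (convex_ball z₀ δ).segment_subset hζp hz hξ
    have h2 : G (p, (0, ζ p)) ≤ G (p, (0, z)) := by
      refine apply_le_of_monotone_fderiv (g := fun z => G (p, (0, z)))
        (fun ξ hξ => (hder ξ (hseg ξ hξ)).differentiableAt) ((hder _ hζp).fderiv.trans hcp)
        fun ξ hξ => ?_
      rw [(hder ξ (hseg ξ hξ)).fderiv, (hder _ hζp).fderiv]
      exact le_trans (by positivity) (hmono p ξ (ζ p) (hp.trans_le (min_le_left _ _))
        ((hseg ξ hξ).trans_le (min_le_left _ _)) (hζp.trans_le (min_le_left _ _)))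
    exact h2.trans h1
  · have hq1 : ∀ᶠ q in 𝓝 (p₀, ((0 : κ → ℝ), z₀)), dist q.1 p₀ < δ ∧ dist (ζ q.1) z₀ < δ ∧
        freeDeriv G (q.1, ζ q.1) = 0 :=
      (continuousAt_fst (p := (p₀, ((0 : κ → ℝ), z₀)))).eventually hζev
    have hq2 : ∀ᶠ q in 𝓝 (p₀, ((0 : κ → ℝ), z₀)), q.2 ∈ Metric.ball ((0 : κ → ℝ), z₀) δ :=
      (continuousAt_snd (p := (p₀, ((0 : κ → ℝ), z₀)))).eventually (Metric.ball_mem_nhds _ hδ)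
    filter_upwards [hq1, hq2] with q ⟨hp, hζp, hcp⟩ hsb hsC hmin
    obtain ⟨p, s⟩ := q
    obtain ⟨hd, hdG, hn⟩ := hnear' p s hp hsb
    have hy : s.1 = 0 := fst_eq_zero_of_isLocalMinOn_orthant hd hn hsC hmin
    obtain ⟨y, z⟩ := s
    simp only at hy
    subst hy
    have hz : dist z z₀ < δ := lt_of_le_of_lt (le_max_right _ _) hsb
    have hz0 : freeDeriv G (p, z) = 0 := by
      ext d
      have := fderiv_apply_eq_zero_of_isLocalMin_line (d := ((0 : κ → ℝ), d)) hd hmin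
        (Eventually.of_forall fun t => by simpa using zero_mem_orthant E (z + t • d))
      rwa [fderiv_slice hdG] at this
    -- Both `z` and `ζ p` are zeros of `freeDeriv G (p, ·)`, and strong monotonicity allows only
    -- one.
    have hm := hmono p z (ζ p) (hp.trans_le (min_le_left _ _)) (hz.trans_le (min_le_left _ _))
      (hζp.trans_le (min_le_left _ _))
    simp only at hcp
    rw [hz0, hcp] at hm
    have hle : α * ‖z - ζ p‖ ^ 2 ≤ 0 := by simpa using hm
    have : ‖z - ζ p‖ = 0 := by
      by_contra hne
      have : 0 < α * ‖z - ζ p‖ ^ 2 := by positivity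
      linarith
    rw [norm_eq_zero, sub_eq_zero] at this
    simp [this]

end OrthantSolution

/-! ### Parametric sensitivity of nonlinear programs -/

section NonlinearProgram

/-- A nonzero functional vanishing on a proper range would have coefficients giving a nontrivial
linear relation among the `l i`. -/
theorem pi_surjective_of_linearIndependent {V κ : Type*} [NormedAddCommGroup V] [NormedSpace ℝ V]
    [Finite κ] {l : κ → V →L[ℝ] ℝ} (hl : LinearIndependent ℝ l) :
    Function.Surjective (ContinuousLinearMap.pi l) := by
  classical
  have := Fintype.ofFinite κ
  rw [← ContinuousLinearMap.coe_coe, ← LinearMap.range_eq_top]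
  by_contra hne
  obtain ⟨f, hf, hle⟩ := Submodule.exists_le_ker_of_lt_top _ (lt_top_iff_ne_top.2 hne)
  have hzero : ∑ i, f (Pi.single i 1) • l i = 0 := by
    ext v
    have h1 : f (ContinuousLinearMap.pi l v) = 0 := hle ⟨v, rfl⟩
    rw [LinearMap.pi_apply_eq_sum_univ f] at h1
    rw [sum_apply]
    simp only [smul_eq_mul, ContinuousLinearMap.pi_apply, smul_apply] at h1 ⊢
    rw [zero_apply, ← h1]
    refine Finset.sum_congr rfl fun i _ => ?_
    rw [mul_comm]
    congr 2
    funext j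
    simp [Pi.single_apply, eq_comm]
  refine hf (LinearMap.pi_ext' fun i => LinearMap.ext_ring ?_)
  simpa using Fintype.linearIndependent_iff.1 hl _ hzero i

/-- The free variables are the common kernel of the `l i`, read off by a continuous projection onto
it. -/
theorem exists_complementary_coordinates {V κ : Type*} [NormedAddCommGroup V] [NormedSpace ℝ V]
    [FiniteDimensional ℝ V] [Fintype κ] {l : κ → V →L[ℝ] ℝ} (hl : LinearIndependent ℝ l) :
    ∃ (Z : Submodule ℝ V) (π : V →L[ℝ] Z),
      ((ContinuousLinearMap.pi l).prod π).IsInvertible := by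
  obtain ⟨π, hπ⟩ := (ContinuousLinearMap.pi l).ker_closedComplemented_of_finiteDimensional_range
  refine ⟨_, π, isInvertible_of_bijective _ ⟨?_, ?_⟩⟩
  · rw [injective_iff_map_eq_zero]
    intro v hv
    have h1 : ContinuousLinearMap.pi l v = 0 := congrArg Prod.fst hv
    have h2 : π v = 0 := congrArg Prod.snd hv
    have := hπ ⟨v, h1⟩
    rw [h2] at this
    exact (congrArg Subtype.val this).symm
  · rintro ⟨y, z⟩
    obtain ⟨v, hv⟩ := pi_surjective_of_linearIndependent hl y
    refine ⟨v - (π v : V) + z, Prod.ext ?_ ?_⟩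
    · have h1 : ContinuousLinearMap.pi l (π v : V) = 0 := (π v).2
      have h2 : ContinuousLinearMap.pi l (z : V) = 0 := z.2
      change ContinuousLinearMap.pi l (v - (π v : V) + z) = y
      rw [map_add, map_sub, h1, h2, hv, sub_zero, add_zero]
    · change π (v - (π v : V) + z) = z
      rw [map_add, map_sub, hπ, hπ, sub_self, zero_add]

/-- Local minimisers of `F` over the feasible points of a constraint system. -/
def IsLocalSolution {V ι : Type*} [TopologicalSpace V] (F : V → ℝ) (c : ι → V → ℝ) (E : Set ι)
    (v : V) : Prop :=
  v ∈ feasibleSet c E ∧ IsLocalMinOn F (feasibleSet c E) v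

/-- Carries local minimality between controls and coordinates, in both directions; `φ` is only
required to be continuous at one point and to respect feasibility and cost locally. -/
theorem isLocalMinOn_comp {X Y : Type*} [TopologicalSpace X] [TopologicalSpace Y] {f : X → ℝ}
    {g : Y → ℝ} {φ : Y → X} {C : Set X} {D : Set Y} {y : Y} (hmin : IsLocalMinOn f C (φ y))
    (hφ : ContinuousAt φ y) (hDC : ∀ᶠ y' in 𝓝 y, y' ∈ D → φ y' ∈ C)
    (hfg : ∀ᶠ y' in 𝓝 y, f (φ y') = g y') : IsLocalMinOn g D y := by
  have ht : Tendsto φ (𝓝[D] y) (𝓝[C] (φ y)) := tendsto_nhdsWithin_iff.2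
    ⟨hφ.tendsto.mono_left nhdsWithin_le_nhds, eventually_nhdsWithin_iff.2 hDC⟩
  have hy := hfg.self_of_nhds
  filter_upwards [ht.eventually hmin, nhdsWithin_le_nhds hfg] with y' h1 h2
  rwa [hy, h2] at h1

variable {Θ V ι : Type*}
    [NormedAddCommGroup Θ] [NormedSpace ℝ Θ] [NormedAddCommGroup V] [NormedSpace ℝ V]

theorem eventually_slice {X Y : Type*} [TopologicalSpace X] [TopologicalSpace Y] {Q : X × Y → Prop}
    {q : X × Y} (h : ∀ᶠ q' in 𝓝 q, Q q') : ∀ᶠ y in 𝓝 q.2, Q (q.1, y) :=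
  ((Continuous.prodMk_right q.1).continuousAt (x := q.2)).eventually h

theorem lagrangian_eq_add_sum_active [Fintype ι] {F : V → ℝ} {c : ι → V → ℝ} {mult : ι → ℝ} {u : V}
    [Fintype {i // c i u = 0}]
    (hcompl : ∀ i, mult i * c i u = 0) (v : V) :
    lagrangian F c mult v = F v + ∑ i : {i // c i u = 0}, mult i * c i v := by
  classical
  rw [lagrangian, ← Finset.sum_subtype (Finset.univ.filter fun i => c i u = 0) (by simp)
    (fun i => mult i * c i v), Finset.sum_filter_of_ne]
  intro i _ hne
  exact (mul_eq_zero.1 (hcompl i)).resolve_left (left_ne_zero_of_mul hne)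

/-- Derivatives of the cost in coordinates in which the active constraints are linear. -/
theorem derivatives_in_coordinates {S : Type*} [NormedAddCommGroup S] [NormedSpace ℝ S]
    {F L : V → ℝ} {φ : S → V} {s : S} {m : S →L[ℝ] ℝ} (hL : ContDiffAt ℝ 2 L (φ s)) (hφ : ContDiffAt ℝ 2 φ s)
    (hcrit : fderiv ℝ L (φ s) = 0) (hFL : ∀ᶠ t in 𝓝 s, F (φ t) = L (φ t) - m t) :
    (∀ d, fderiv ℝ (fun t => F (φ t)) s d = - m d) ∧
      ∀ d, fderiv ℝ (fderiv ℝ (fun t => F (φ t))) s d d =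
        fderiv ℝ (fderiv ℝ L) (φ s) (fderiv ℝ φ s d) (fderiv ℝ φ s d) := by
  have hLφ : ContDiffAt ℝ 2 (fun t => L (φ t)) s := hL.comp s hφ
  have hev : fderiv ℝ (fun t => F (φ t)) =ᶠ[𝓝 s] fun t => fderiv ℝ (fun t => L (φ t)) t - m := by
    filter_upwards [EventuallyEq.fderiv (𝕜 := ℝ) hFL, hLφ.eventually (by simp)] with t h1 h2
    rw [h1]
    exact ((h2.differentiableAt (by simp)).hasFDerivAt.sub m.hasFDerivAt).fderiv
  constructor
  · intro d
    rw [hev.self_of_nhds]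
    have : fderiv ℝ (fun t => L (φ t)) s = (fderiv ℝ L (φ s)).comp (fderiv ℝ φ s) :=
      fderiv_comp s (hL.differentiableAt (by simp)) (hφ.differentiableAt (by simp))
    simp [this, hcrit]
  · intro d
    -- The curvature of `φ` enters only through `fderiv ℝ L (φ s)`, which vanishes, and `m` is
    -- linear. So the Hessian transforms as a quadratic form.
    rw [hev.fderiv_eq, fderiv_sub_const, fderiv_fderiv_comp hL hφ, hcrit]
    simp

/-- Parametric sensitivity of nonlinear programs: under LICQ, the second order sufficient
conditions and strict complementarity, there is a continuously differentiable curve of local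
solutions, and it contains all local solutions near the given one. -/
theorem exists_local_solution [CompleteSpace Θ] [FiniteDimensional ℝ V] [Fintype ι]
    {F : Θ × V → ℝ} {c : ι → Θ × V → ℝ} {E : Set ι} {p₀ : Θ} {u₀ : V} {mult : ι → ℝ}
    (hF : ContDiffAt ℝ 2 F (p₀, u₀)) (hc : ∀ i, ContDiffAt ℝ 2 (c i) (p₀, u₀))
    (hlicq : LICQ (fun i v => c i (p₀, v)) u₀)
    (hssoc : SSOC (fun v => F (p₀, v)) (fun i v => c i (p₀, v)) E u₀ mult)
    (hsc : StrictComplementarity (fun i v => c i (p₀, v)) E u₀ mult) :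
    ∃ v : Θ → V, v p₀ = u₀ ∧ ContDiffAt ℝ 1 v p₀ ∧
      (∀ᶠ p in 𝓝 p₀, IsLocalSolution (fun v => F (p, v)) (fun i v => c i (p, v)) E (v p)) ∧
      ∀ᶠ q in 𝓝 (p₀, u₀), IsLocalSolution (fun v => F (q.1, v)) (fun i v => c i (q.1, v)) E q.2 →
        q.2 = v q.1 := by
  classical
  have : CompleteSpace V := FiniteDimensional.complete ℝ V
  obtain ⟨hkkt, hhess⟩ := hssoc
  obtain ⟨Z, π, hT⟩ := exists_complementary_coordinates hlicq
  set A := {i // c i (p₀, u₀) = 0} with hA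
  set ψ : Θ × V → (A → ℝ) × Z := fun q => (fun i => c i q, π q.2) with hψdef
  have hψ : ContDiffAt ℝ 2 ψ (p₀, u₀) :=
    (contDiffAt_pi.2 fun i : A => hc i).prodMk (by fun_prop)
  set l : A → V →L[ℝ] ℝ := fun i => fderiv ℝ (fun v => c i (p₀, v)) u₀ with hldef
  set T := (ContinuousLinearMap.pi l).prod π with hTdef
  have hψslice : HasFDerivAt (fun v => ψ (p₀, v)) T u₀ := by
    refine (hasFDerivAt_pi.2 fun i : A => ?_).prodMk π.hasFDerivAt
    exact (((hc i).differentiableAt (by simp)).comp u₀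
      (hasFDerivAt_prodMk_right p₀ u₀).differentiableAt).hasFDerivAt
  have hψinr : fderiv ℝ ψ (p₀, u₀) ∘L ContinuousLinearMap.inr ℝ Θ V = T :=
    ((hψ.differentiableAt (by simp)).hasFDerivAt.comp u₀
      (hasFDerivAt_prodMk_right p₀ u₀)).unique hψslice
  have hψ0 : ψ (p₀, u₀) = (0, π u₀) := Prod.ext (funext fun i => i.2) rfl
  obtain ⟨φ, hφ0, hφ, hψφ, hφψ⟩ := exists_local_coordinates hψ (by rw [hψinr]; exact hT)
  simp only [hψ0] at hφ0 hφ hψφ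
  set s₀ : (A → ℝ) × Z := (0, π u₀) with hs₀
  set E' : Set A := {i | i.1 ∈ E} with hE'
  -- the cost in the coordinates `s = ψ (p, v)`
  set G : Θ × ((A → ℝ) × Z) → ℝ := fun q => F (q.1, φ q) with hGdef
  have hG : ContDiffAt ℝ 2 G (p₀, s₀) := by
    refine ContDiffAt.comp (p₀, s₀) (g := F) (f := fun q => (q.1, φ q)) ?_
      (contDiffAt_fst.prodMk hφ)
    simpa [hφ0] using hF
  have hφs : ContDiffAt ℝ 2 (fun s => φ (p₀, s)) s₀ :=
    ContDiffAt.comp s₀ (g := φ) (f := fun s => (p₀, s)) hφ (by fun_prop)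
  have hψφs : ∀ᶠ s in 𝓝 s₀, ψ (p₀, φ (p₀, s)) = s := eventually_slice hψφ
  set L := lagrangian (fun v => F (p₀, v)) (fun i v => c i (p₀, v)) mult with hLdef
  have hL : ContDiffAt ℝ 2 L u₀ := by
    have hsl : ∀ f : Θ × V → ℝ, ContDiffAt ℝ 2 f (p₀, u₀) → ContDiffAt ℝ 2 (fun v => f (p₀, v)) u₀ :=
      fun f hf => ContDiffAt.comp u₀ (g := f) (f := fun v => (p₀, v)) hf (by fun_prop)
    exact (hsl F hF).add (ContDiffAt.sum fun i _ => contDiffAt_const.mul (hsl _ (hc i)))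
  -- The multiplier terms of the Lagrangian: in the new coordinates the active constraints are the
  -- coordinates `y` themselves, so their weighted sum is linear.
  set m : ((A → ℝ) × Z) →L[ℝ] ℝ := ∑ i : A, mult i •
    (ContinuousLinearMap.proj i).comp (ContinuousLinearMap.fst ℝ (A → ℝ) Z) with hm
  have hmapp : ∀ s, m s = ∑ i : A, mult i * s.1 i := fun s => by
    simp [hm]
  have hFL : ∀ᶠ s in 𝓝 s₀, F (p₀, φ (p₀, s)) = L (φ (p₀, s)) - m s := by
    filter_upwards [hψφs] with s hs
    have h1 := lagrangian_eq_add_sum_active (F := fun v => F (p₀, v))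
      (c := fun i v => c i (p₀, v)) (u := u₀) hkkt.complementary (φ (p₀, s))
    have h2 : m s = ∑ i : A, mult i * c i (p₀, φ (p₀, s)) := by
      rw [hmapp]
      exact Finset.sum_congr rfl fun i _ => by rw [← congrFun (congrArg Prod.fst hs) i]
    rw [h2, hLdef, h1]
    ring
  obtain ⟨hd1, hd2⟩ := derivatives_in_coordinates (F := fun v => F (p₀, v)) (L := L) (m := m)
    (by rw [hφ0]; exact hL) hφs (by rw [hφ0]; exact hkkt.stationary) hFL
  -- The derivative of `φ (p₀, ·)` is a right inverse of `T`. Hence it sends `(0, z)` to a direction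
  -- annihilated by all active gradients, that is, into the critical cone, and this direction is
  -- nonzero if `z` is.
  have hTφ : ∀ d, T (fderiv ℝ (fun s => φ (p₀, s)) s₀ d) = d := by
    have h1 : HasFDerivAt (fun s => ψ (p₀, φ (p₀, s)))
        (T.comp (fderiv ℝ (fun s => φ (p₀, s)) s₀)) s₀ := by
      refine HasFDerivAt.comp (g := fun v => ψ (p₀, v)) s₀ ?_
        (hφs.differentiableAt (by simp)).hasFDerivAt
      rw [hφ0]
      exact hψslice
    have h2 := h1.unique ((hasFDerivAt_id s₀).congr_of_eventuallyEq hψφs)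
    intro d
    exact congrArg (fun R : _ →L[ℝ] _ => R d) h2
  obtain ⟨ζ, hζ0, hζd, hζmin, hζuniq⟩ := exists_local_solution_orthant (G := G) (E := E') hG
    (by
      intro i hi
      rw [hd1, hmapp, Finset.sum_eq_single i (fun j _ hj => by simp [Pi.single_eq_of_ne hj])
        (by simp)]
      simpa using hsc i hi i.2)
    (by
      intro z
      rw [hd1, hmapp]
      simp)
    (by
      intro z hz
      rw [hd2, hφ0]
      set d := fderiv ℝ (fun s => φ (p₀, s)) s₀ (0, z) with hd
      have hTd : T d = (0, z) := hTφ _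
      have hl0 : ∀ i : A, l i d = 0 := fun i => congrFun (congrArg Prod.fst hTd) i
      refine hhess d ⟨fun i hi => hl0 ⟨i, (hkkt.feasible i).2 hi⟩, fun i _ h0 =>
        ⟨(hl0 ⟨i, h0⟩).le, fun _ => hl0 ⟨i, h0⟩⟩⟩ ?_
      intro hd0
      rw [hd0, map_zero] at hTd
      exact hz (congrArg Prod.snd hTd).symm)
  -- near `(p₀, u₀)` only the active constraints matter
  have hinact : ∀ᶠ q in 𝓝 (p₀, u₀), ∀ i, c i (p₀, u₀) ≠ 0 → c i q < 0 := by
    refine eventually_all.2 fun i => ?_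
    by_cases hi : c i (p₀, u₀) = 0
    · simp [hi]
    · have : c i (p₀, u₀) < 0 := lt_of_le_of_ne (hkkt.feasible i).1 hi
      exact ((hc i).continuousAt.eventually (eventually_lt_nhds this)).mono fun q hq _ => hq
  have hfeas : ∀ᶠ q in 𝓝 (p₀, u₀),
      (q.2 ∈ feasibleSet (fun i v => c i (q.1, v)) E ↔ ψ q ∈ orthant Z E') := by
    filter_upwards [hinact] with q hq
    refine ⟨fun h i => h i, fun h i => ?_⟩
    by_cases hi : c i (p₀, u₀) = 0
    · exact h ⟨i, hi⟩
    · exact ⟨(hq i hi).le, fun hiE => absurd ((hkkt.feasible i).2 hiE) hi⟩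
  have hψc : ∀ᶠ q in 𝓝 (p₀, u₀), ContinuousAt ψ q :=
    (hψ.eventually (by simp)).mono fun q hq => hq.continuousAt
  have hφc : ∀ᶠ q in 𝓝 (p₀, s₀), ContinuousAt φ q :=
    (hφ.eventually (by simp)).mono fun q hq => hq.continuousAt
  -- Local minimality at a nearby point involves a whole neighbourhood of that point, hence the
  -- passage to `eventually_nhds`.
  have hVnhds := (hfeas.and (hψc.and hφψ)).eventually_nhds
  have hSnhds := (hψφ.and hφc).eventually_nhds
  have htoV : Tendsto (fun q : Θ × ((A → ℝ) × Z) => (q.1, φ q)) (𝓝 (p₀, s₀)) (𝓝 (p₀, u₀)) := by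
    have := (continuousAt_fst (p := (p₀, s₀))).prodMk hφ.continuousAt
    rw [ContinuousAt, hφ0] at this
    exact this
  have htoS : Tendsto (fun q : Θ × V => (q.1, ψ q)) (𝓝 (p₀, u₀)) (𝓝 (p₀, s₀)) := by
    have := (continuousAt_fst (p := (p₀, u₀))).prodMk hψ.continuousAt
    rw [ContinuousAt, hψ0] at this
    exact this
  have hζs : ContDiffAt ℝ 1 (fun p => (p, (((0 : A → ℝ), ζ p) : (A → ℝ) × Z))) p₀ :=
    contDiffAt_id.prodMk (contDiffAt_const.prodMk hζd)
  have hζt : Tendsto (fun p => (p, (((0 : A → ℝ), ζ p) : (A → ℝ) × Z))) (𝓝 p₀) (𝓝 (p₀, s₀)) := by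
    have := hζs.continuousAt
    rw [ContinuousAt, hζ0] at this
    exact this
  refine ⟨fun p => φ (p, (0, ζ p)), by simp only [hζ0]; exact hφ0, ?_, ?_, ?_⟩
  · refine ContDiffAt.comp p₀ (g := φ) ?_ hζs
    simp only [hζ0]
    exact hφ.of_le (by norm_num)
  · filter_upwards [hζmin, hζt.eventually hSnhds, hζt.eventually (htoV.eventually hVnhds)]
      with p hmin hS hV
    have hs : ψ (p, φ (p, (0, ζ p))) = (0, ζ p) := hS.self_of_nhds.1
    have hV' := eventually_slice hV
    obtain ⟨hf, hψcp, -⟩ := hV.self_of_nhds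
    refine ⟨hf.2 (by rw [hs]; exact zero_mem_orthant _ _), ?_⟩
    refine isLocalMinOn_comp (f := fun s => G (p, s)) (φ := fun v => ψ (p, v)) ?_ ?_ ?_ ?_
      (D := feasibleSet (fun i v => c i (p, v)) E) (C := orthant Z E')
    · rw [hs]
      exact hmin
    · exact ContinuousAt.comp (g := ψ) hψcp (by fun_prop)
    · exact hV'.mono fun v hv => hv.1.1
    · exact hV'.mono fun v hv => by
        simp only [hGdef]
        rw [hv.2.2]
  · filter_upwards [hVnhds, htoS.eventually hSnhds, htoS.eventually hζuniq] with q hV hS huniq hsol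
    obtain ⟨p, v⟩ := q
    obtain ⟨hfe, -, hv⟩ := hV.self_of_nhds
    simp only at hv
    have hS' := eventually_slice hS
    have hcφ : ContinuousAt (fun s => φ (p, s)) (ψ (p, v)) :=
      ContinuousAt.comp (g := φ) hS.self_of_nhds.2 (by fun_prop)
    have hV' := eventually_slice hV
    simp only at hS' hV'
    rw [← hv] at hV'
    -- A local solution in `v` becomes a local minimiser on the orthant in coordinates, where
    -- uniqueness is known.
    have hkey : ψ (p, v) = (0, ζ p) := by
      refine huniq (hfe.1 hsol.1) ?_
      refine isLocalMinOn_comp (f := fun v => F (p, v)) (φ := fun s => φ (p, s)) ?_ hcφ ?_ ?_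
        (C := feasibleSet (fun i v => c i (p, v)) E)
      · simp only [hv]
        exact hsol.2
      · filter_upwards [hS', hcφ.eventually hV'] with s h1 h2 hsD
        refine h2.1.2 ?_
        rw [h1.1]
        exact hsD
      · exact Eventually.of_forall fun s => rfl
    simp only
    rw [← hkey, hv]

end NonlinearProgram

/-! ### Regularity of trajectories, costs and constraints -/

section Smoothness

variable {X U W : Type*}
  [NormedAddCommGroup X] [NormedSpace ℝ X] [NormedAddCommGroup U] [NormedSpace ℝ U]
  [NormedAddCommGroup W] [NormedSpace ℝ W] {N : ℕ} {P : ControlProblem X U W}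

theorem ControlProblem.isLocallyOptimal_iff (P : ControlProblem X U W) (x : X)
    (w : Fin (N + 1) → W) (u : Fin (N + 1) → U) :
    P.IsLocallyOptimal x w u ↔
      IsLocalSolution (fun u' => P.cost x u' w) (P.constraint x w) (P.eqIndices N) u := by
  rw [ControlProblem.IsLocallyOptimal, P.admissible_eq_feasibleSet, IsLocalSolution]

theorem continuous_traj (hf : Continuous (fun q : X × U × W => P.f q.1 q.2.1 q.2.2))
    (k : Fin (N + 2)) :
    Continuous (fun q : (X × (Fin (N + 1) → W)) × (Fin (N + 1) → U) =>
      P.traj q.1.1 q.2 q.1.2 k) := by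
  induction k using Fin.induction with
  | zero => exact continuous_fst.fst
  | succ k ih =>
    exact hf.comp (f := fun q : (X × (Fin (N + 1) → W)) × (Fin (N + 1) → U) =>
      (P.traj q.1.1 q.2 q.1.2 k.castSucc, q.2 k, q.1.2 k)) (by fun_prop)

theorem continuous_cost (hf : Continuous (fun q : X × U × W => P.f q.1 q.2.1 q.2.2))
    (hl : Continuous (fun q : X × U × W => P.stageCost q.1 q.2.1 q.2.2)) :
    Continuous (fun q : (X × (Fin (N + 1) → W)) × (Fin (N + 1) → U) =>
      P.cost q.1.1 q.2 q.1.2) := by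
  refine continuous_finsetSum _ fun k _ => ?_
  have := continuous_traj hf k.castSucc
  exact hl.comp (f := fun q : (X × (Fin (N + 1) → W)) × (Fin (N + 1) → U) =>
    (P.traj q.1.1 q.2 q.1.2 k.castSucc, q.2 k, q.1.2 k)) (by fun_prop)

variable {x : X} {w : Fin (N + 1) → W} {u : Fin (N + 1) → U}

theorem SensitivityConditions.contDiffAt_traj (h : SensitivityConditions P x w u)
    (k : Fin (N + 2)) :
    ContDiffAt ℝ 2 (fun q : (X × (Fin (N + 1) → W)) × (Fin (N + 1) → U) =>
      P.traj q.1.1 q.2 q.1.2 k) ((x, w), u) := by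
  induction k using Fin.induction with
  | zero => exact contDiffAt_fst.fst
  | succ k ih =>
    exact ContDiffAt.comp ((x, w), u) (f := fun q : (X × (Fin (N + 1) → W)) × (Fin (N + 1) → U) =>
      (P.traj q.1.1 q.2 q.1.2 k.castSucc, q.2 k, q.1.2 k)) (h.smooth_f k)
      (ih.prodMk (by fun_prop))

theorem SensitivityConditions.contDiffAt_stageCost (h : SensitivityConditions P x w u)
    (k : Fin (N + 1)) :
    ContDiffAt ℝ 2 (fun q : (X × (Fin (N + 1) → W)) × (Fin (N + 1) → U) =>
      P.stageCost (P.traj q.1.1 q.2 q.1.2 k.castSucc) (q.2 k) (q.1.2 k)) ((x, w), u) :=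
  ContDiffAt.comp ((x, w), u) (f := fun q : (X × (Fin (N + 1) → W)) × (Fin (N + 1) → U) =>
    (P.traj q.1.1 q.2 q.1.2 k.castSucc, q.2 k, q.1.2 k)) (h.smooth_stageCost k)
    ((h.contDiffAt_traj k.castSucc).prodMk (by fun_prop))

theorem SensitivityConditions.contDiffAt_cost (h : SensitivityConditions P x w u) :
    ContDiffAt ℝ 2 (fun q : (X × (Fin (N + 1) → W)) × (Fin (N + 1) → U) =>
      P.cost q.1.1 q.2 q.1.2) ((x, w), u) :=
  ContDiffAt.sum fun k _ => h.contDiffAt_stageCost k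

theorem SensitivityConditions.contDiffAt_constraint (h : SensitivityConditions P x w u)
    (i : (Fin P.nX × Fin (N + 1)) ⊕ (Fin P.nU × Fin (N + 1))) :
    ContDiffAt ℝ 2 (fun q : (X × (Fin (N + 1) → W)) × (Fin (N + 1) → U) =>
      P.constraint q.1.1 q.1.2 i q.2) ((x, w), u) := by
  rcases i with ⟨i, k⟩ | ⟨j, k⟩
  · exact ContDiffAt.comp ((x, w), u) (g := P.gX i)
      (f := fun q : (X × (Fin (N + 1) → W)) × (Fin (N + 1) → U) =>
        P.traj q.1.1 q.2 q.1.2 k.succ) (h.smooth_gX i k) (h.contDiffAt_traj k.succ)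
  · exact ContDiffAt.comp ((x, w), u) (g := P.gU j)
      (f := fun q : (X × (Fin (N + 1) → W)) × (Fin (N + 1) → U) => q.2 k)
      (h.smooth_gU j k) (by fun_prop)

end Smoothness

/-! ### Existence, uniqueness and continuity of the sensitivity -/

section Sensitivity

variable {X U W : Type*}
  [NormedAddCommGroup X] [NormedSpace ℝ X] [CompleteSpace X]
  [NormedAddCommGroup U] [NormedSpace ℝ U] [FiniteDimensional ℝ U]
  [NormedAddCommGroup W] [NormedSpace ℝ W] [CompleteSpace W]
  {N : ℕ} {P : ControlProblem X U W}
  {x : X} {w : Fin (N + 1) → W} {u : Fin (N + 1) → U}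

theorem SensitivityConditions.exists_local_control (h : SensitivityConditions P x w u) :
    ∃ v : X × (Fin (N + 1) → W) → (Fin (N + 1) → U), v (x, w) = u ∧ ContDiffAt ℝ 1 v (x, w) ∧
      (∀ᶠ p in 𝓝 (x, w), P.IsLocallyOptimal p.1 p.2 (v p)) ∧
      ∀ᶠ q in 𝓝 ((x, w), u), P.IsLocallyOptimal q.1.1 q.1.2 q.2 → q.2 = v q.1 := by
  obtain ⟨mult, hssoc, hsc⟩ := h.ssoc_scc
  simp only [P.isLocallyOptimal_iff]
  exact exists_local_solution h.contDiffAt_cost h.contDiffAt_constraint h.licq hssoc hsc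

/-- Any competing map is differentiable, hence continuous, at `(x, w)`. Its values are therefore
local solutions close to `u` and agree with the branch `v` nearby. -/
theorem SensitivityConditions.isSensitivity_unique (h : SensitivityConditions P x w u)
    {S S' : X × (Fin (N + 1) → W) →L[ℝ] (Fin (N + 1) → U)} (hS : IsSensitivity P x w u S)
    (hS' : IsSensitivity P x w u S') : S = S' := by
  obtain ⟨v, -, -, -, huniq⟩ := h.exists_local_control
  have key : ∀ T, IsSensitivity P x w u T → HasFDerivAt v T (x, w) := by
    rintro T ⟨v', hv', hopt, hder⟩
    refine hder.congr_of_eventuallyEq ?_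
    have ht : Tendsto (fun p => (p, v' p)) (𝓝 (x, w)) (𝓝 ((x, w), u)) := by
      have := (continuousAt_id (x := (x, w))).prodMk hder.continuousAt
      rwa [ContinuousAt, hv'] at this
    filter_upwards [hopt, ht.eventually huniq] with p h1 h2
    exact (h2 h1).symm
  exact (key S hS).unique (key S' hS')

theorem SensitivityConditions.existsUnique_isSensitivity (h : SensitivityConditions P x w u) :
    ∃! S, IsSensitivity P x w u S := by
  obtain ⟨v, hv, hd, hopt, -⟩ := h.exists_local_control
  have hS : IsSensitivity P x w u (fderiv ℝ v (x, w)) :=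
    ⟨v, hv, hopt, (hd.differentiableAt (by simp)).hasFDerivAt⟩
  exact ⟨_, hS, fun S' hS' => h.isSensitivity_unique hS' hS⟩

/-- The branch `v` built at one point `p₀` also witnesses the sensitivity at every nearby `p ∈ D`:
`ustar p` is optimal and close to `ustar p₀`, so it equals `v p`. Thus `S` coincides on `D` near
`p₀` with the derivative of a C¹ map. -/
theorem continuousOn_sensitivity {D : Set (X × (Fin (N + 1) → W))}
    {ustar : X × (Fin (N + 1) → W) → (Fin (N + 1) → U)} (hcont : ContinuousOn ustar D)
    (hopt : ∀ p ∈ D, P.IsOptimal p.1 p.2 (ustar p))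
    (hcond : ∀ p ∈ D, SensitivityConditions P p.1 p.2 (ustar p))
    {S : X × (Fin (N + 1) → W) → (X × (Fin (N + 1) → W) →L[ℝ] (Fin (N + 1) → U))}
    (hS : ∀ p ∈ D, IsSensitivity P p.1 p.2 (ustar p) (S p)) : ContinuousOn S D := by
  intro p₀ hp₀
  obtain ⟨v, -, hd, hloc, huniq⟩ := (hcond p₀ hp₀).exists_local_control
  have hfd : ContinuousAt (fderiv ℝ v) p₀ := (hd.fderiv_right (m := 0) (by simp)).continuousAt
  have ht : Tendsto (fun p => (p, ustar p)) (𝓝[D] p₀) (𝓝 (p₀, ustar p₀)) :=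
    (tendsto_id.mono_left nhdsWithin_le_nhds).prodMk_nhds (hcont p₀ hp₀)
  have heq : ∀ p ∈ D, v p = ustar p → ContDiffAt ℝ 1 v p →
      (∀ᶠ p' in 𝓝 p, P.IsLocallyOptimal p'.1 p'.2 (v p')) → S p = fderiv ℝ v p :=
    fun p hp h1 h2 h3 => (hcond p hp).isSensitivity_unique (hS p hp)
      ⟨v, h1, h3, (h2.differentiableAt (by simp)).hasFDerivAt⟩
  have hev : ∀ᶠ p in 𝓝[D] p₀, S p = fderiv ℝ v p := by
    filter_upwards [self_mem_nhdsWithin, ht.eventually huniq,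
      nhdsWithin_le_nhds (hd.eventually (by simp)), nhdsWithin_le_nhds hloc.eventually_nhds]
      with p hp h1 h2 h3
    exact heq p hp (h1 ⟨(hopt p hp).1, (hopt p hp).2.localize⟩).symm h2 h3
  exact hfd.continuousWithinAt.congr_of_eventuallyEq hev (hev.self_of_nhdsWithin hp₀)

end Sensitivity

/-! ### Uniform linear bounds on compact sets -/

section Lipschitz

/-- Local constants are combined by taking maxima over a finite cover. -/
theorem exists_le_mul_of_isCompact {Y : Type*} [TopologicalSpace Y] {T : Set Y} (hT : IsCompact T)
    {a d : Y → ℝ} (hd : ∀ t, 0 ≤ d t)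
    (hloc : ∀ t ∈ T, ∃ L, ∀ᶠ t' in 𝓝[T] t, a t' ≤ L * d t') :
    ∃ L, 0 ≤ L ∧ ∀ t ∈ T, a t ≤ L * d t := by
  refine hT.induction_on (p := fun s => ∃ L, 0 ≤ L ∧ ∀ t ∈ s, a t ≤ L * d t)
    ⟨0, le_rfl, by simp⟩ (fun s t hst ⟨L, h0, hL⟩ => ⟨L, h0, fun y hy => hL y (hst hy)⟩) ?_ ?_
  · rintro s t ⟨L, h0, hL⟩ ⟨L', h0', hL'⟩
    refine ⟨max L L', h0.trans (le_max_left _ _), ?_⟩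
    rintro y (hy | hy)
    · exact (hL y hy).trans (mul_le_mul_of_nonneg_right (le_max_left _ _) (hd y))
    · exact (hL' y hy).trans (mul_le_mul_of_nonneg_right (le_max_right _ _) (hd y))
  · intro t ht
    obtain ⟨L, hL⟩ := hloc t ht
    exact ⟨_, hL, max L 0, le_max_right _ _, fun y hy =>
      (show a y ≤ L * d y from hy).trans (mul_le_mul_of_nonneg_right (le_max_left _ _) (hd y))⟩

/-- A cost that is continuous everywhere and continuously differentiable at the nominal points
changes at most linearly under first order updates of the control, uniformly on compact sets. -/
theorem exists_lipschitz_update {Θ V : Type*} [NormedAddCommGroup Θ] [NormedSpace ℝ Θ]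
    [NormedAddCommGroup V] [NormedSpace ℝ V] {Λ : Θ × V → ℝ} (hΛ : Continuous Λ) {D : Set Θ}
    {v : Θ → V} (hv : ContinuousOn v D) {S : Θ → Θ →L[ℝ] V} (hS : ContinuousOn S D)
    (hΛd : ∀ p ∈ D, ContDiffAt ℝ 1 Λ (p, v p)) {T : Set (Θ × Θ)} (hT : IsCompact T)
    (hTD : ∀ t ∈ T, t.2 ∈ D) :
    ∃ L, 0 ≤ L ∧ ∀ t ∈ T, |Λ (t.1, v t.2 + S t.2 (t.1 - t.2)) - Λ (t.2, v t.2)|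
      ≤ L * dist t.1 t.2 := by
  have hvT : ContinuousOn (fun t : Θ × Θ => v t.2) T :=
    hv.comp continuousOn_snd hTD
  have hST : ContinuousOn (fun t : Θ × Θ => S t.2) T :=
    hS.comp continuousOn_snd hTD
  have hnew : ContinuousOn (fun t : Θ × Θ => (t.1, v t.2 + S t.2 (t.1 - t.2))) T :=
    continuousOn_fst.prodMk
      (hvT.add (hST.clm_apply (continuous_fst.sub continuous_snd).continuousOn))
  have hold : ContinuousOn (fun t : Θ × Θ => (t.2, v t.2)) T := continuousOn_snd.prodMk hvT
  refine exists_le_mul_of_isCompact hT (d := fun t => dist t.1 t.2) (fun _ => dist_nonneg) ?_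
  rintro ⟨q, p⟩ ht
  rcases eq_or_ne q p with rfl | hne
  · obtain ⟨C, s, hs, hlip⟩ := (hΛd q (hTD _ ht)).exists_lipschitzOnWith
    have h1 : ∀ᶠ t in 𝓝[T] (q, q), (t.1, v t.2 + S t.2 (t.1 - t.2)) ∈ s := by
      refine (hnew _ ht).eventually ?_
      simpa using hs
    have h2 : ∀ᶠ t in 𝓝[T] (q, q), (t.2, v t.2) ∈ s := (hold _ ht).eventually hs
    have h3 : ∀ᶠ t in 𝓝[T] (q, q), ‖S t.2‖ < ‖S q‖ + 1 :=
      (hST.norm _ ht).eventually (eventually_lt_nhds (by simp))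
    -- `C` is a local Lipschitz constant of `Λ`. The two arguments of `Λ` are at most `max 1 ‖S
    -- t.2‖` times `dist t.1 t.2` apart.
    refine ⟨C * (‖S q‖ + 1), ?_⟩
    filter_upwards [h1, h2, h3] with t m1 m2 m3
    have hd := hlip.dist_le_mul _ m1 _ m2
    rw [Real.dist_eq] at hd
    refine hd.trans ?_
    rw [mul_assoc]
    refine mul_le_mul_of_nonneg_left ?_ C.2
    rw [Prod.dist_eq]
    refine max_le ?_ ?_
    · exact le_mul_of_one_le_left dist_nonneg (by simp)
    · rw [dist_eq_norm, add_sub_cancel_left, dist_eq_norm]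
      exact ((S t.2).le_opNorm _).trans (mul_le_mul_of_nonneg_right m3.le (norm_nonneg _))
  -- Off the diagonal the updated control need not be near a nominal one, so only the global
  -- continuity of `Λ` is available. It suffices, as the distance stays above half its value at `(q,
  -- p)`.
  · set a : Θ × Θ → ℝ := fun t => |Λ (t.1, v t.2 + S t.2 (t.1 - t.2)) - Λ (t.2, v t.2)| with ha
    have hac : ContinuousOn a T :=
      ((hΛ.comp_continuousOn hnew).sub (hΛ.comp_continuousOn hold)).abs
    have hpos : 0 < dist q p := dist_pos.2 hne
    have h1 : ∀ᶠ t in 𝓝[T] (q, p), a t < a (q, p) + 1 :=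
      (hac _ ht).eventually (eventually_lt_nhds (by simp))
    have h2 : ∀ᶠ t in 𝓝[T] (q, p), dist q p / 2 < dist t.1 t.2 :=
      nhdsWithin_le_nhds ((continuous_dist.tendsto (q, p)).eventually
        (eventually_gt_nhds (half_lt_self hpos)))
    refine ⟨(a (q, p) + 1) / (dist q p / 2), ?_⟩
    filter_upwards [h1, h2] with t m1 m2
    have hnn : 0 ≤ a (q, p) := abs_nonneg _
    calc a t ≤ a (q, p) + 1 := m1.le
      _ = (a (q, p) + 1) / (dist q p / 2) * (dist q p / 2) := by field_simp
      _ ≤ _ := by gcongr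

end Lipschitz

/-! ### Compactness of the set of tuples -/

section Tuples

variable {X W : Type*} [NormedAddCommGroup X] [NormedAddCommGroup W] {N : ℕ}

theorem IsTuple.mono {A B : Set X} (hAB : A ⊆ B) {Wset : Set W} {Δx Δw : ℝ} {xbar x : X}
    {wbar w : Fin (N + 1) → W} (h : IsTuple A Wset Δx Δw xbar x wbar w) :
    IsTuple B Wset Δx Δw xbar x wbar w :=
  { h with xbar_mem := hAB h.xbar_mem, x_mem := hAB h.x_mem }

theorem isCompact_setOf_isTuple (N : ℕ) {K : Set X} (hK : IsCompact K) {Wset : Set W}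
    (hW : IsCompact Wset) (Δx Δw : ℝ) :
    IsCompact {t : (X × (Fin (N + 1) → W)) × (X × (Fin (N + 1) → W)) |
      IsTuple K Wset Δx Δw t.1.1 t.2.1 t.1.2 t.2.2} := by
  have hpi : IsCompact (Set.univ.pi fun _ : Fin (N + 1) => Wset) := isCompact_univ_pi fun _ => hW
  have hc := (hK.prod hpi).prod (hK.prod hpi)
  have hcl : IsClosed {t : (X × (Fin (N + 1) → W)) × (X × (Fin (N + 1) → W)) |
      dist t.1.1 t.2.1 ≤ Δx ∧ (∀ k, dist (t.1.2 k) (t.2.2 k) ≤ Δw) ∧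
        ∀ k : Fin N, dist (t.1.2 k.succ) (t.1.2 k.castSucc) ≤ Δw} := by
    simp only [Set.ofPred_and, Set.ofPred_forall]
    refine (isClosed_le (by fun_prop) (by fun_prop)).inter ((isClosed_iInter fun k => ?_).inter
      (isClosed_iInter fun k => ?_)) <;> exact isClosed_le (by fun_prop) (by fun_prop)
  convert hc.inter_right hcl using 1
  ext t
  constructor
  · exact fun h => ⟨⟨⟨h.xbar_mem, fun k _ => h.wbar_mem k⟩, ⟨h.x_mem, fun k _ => h.w_mem k⟩⟩,
      h.state_bound, h.disturbance_bound, h.change_bound⟩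
  · rintro ⟨⟨⟨h1, h2⟩, ⟨h3, h4⟩⟩, h5, h6, h7⟩
    exact ⟨h1, h3, fun k => h2 k trivial, fun k => h4 k trivial, h5, h6, h7⟩

end Tuples

end MPC

/-! ### The Lipschitz assumption for the sensitivity update -/

theorem proposition4p2
    {X U W : Type*}
    [NormedAddCommGroup X] [NormedSpace ℝ X] [CompleteSpace X]
    [NormedAddCommGroup U] [NormedSpace ℝ U] [FiniteDimensional ℝ U]
    [NormedAddCommGroup W] [NormedSpace ℝ W] [CompleteSpace W]
    (P : MPC.ControlProblem X U W) (N : ℕ)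
    (hf : Continuous (fun q : X × U × W => P.f q.1 q.2.1 q.2.2))
    (hl : Continuous (fun q : X × U × W => P.stageCost q.1 q.2.1 q.2.2))
    (Wset : Set W) (hW : IsCompact Wset)
    (Δx Δw : ℝ) (hΔx : 0 < Δx) (hΔw : 0 < Δw)
    (xstar : X) (A : Set X) (hAstar : xstar ∈ A) (hA : A ⊆ P.stateSet)
    (ustar : X → (Fin (N + 1) → W) → (Fin (N + 1) → U))
    (hcont : ContinuousOn (fun p : X × (Fin (N + 1) → W) => ustar p.1 p.2)
      (MPC.nominalPairs N A Wset Δx Δw))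
    (hopt : ∀ (xbar x : X) (wbar w : Fin (N + 1) → W),
      MPC.IsTuple A Wset Δx Δw xbar x wbar w → P.IsOptimal x w (ustar x w))
    (hcond : ∀ (xbar x : X) (wbar w : Fin (N + 1) → W),
      MPC.IsTuple A Wset Δx Δw xbar x wbar w →
        MPC.SensitivityConditions P x w (ustar x w)) :
    (∀ p ∈ MPC.nominalPairs N A Wset Δx Δw,
      ∃! S : X × (Fin (N + 1) → W) →L[ℝ] (Fin (N + 1) → U),
        MPC.IsSensitivity P p.1 p.2 (ustar p.1 p.2) S) ∧
    ∀ S : X → (Fin (N + 1) → W) → (X × (Fin (N + 1) → W) →L[ℝ] (Fin (N + 1) → U)),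
      (∀ p ∈ MPC.nominalPairs N A Wset Δx Δw,
        MPC.IsSensitivity P p.1 p.2 (ustar p.1 p.2) (S p.1 p.2)) →
      ∀ K : Set X, IsCompact K → K ⊆ A → xstar ∈ K →
        MPC.LipschitzAssumption P Wset Δx Δw xstar ustar S K := by
  have hcond' : ∀ p ∈ MPC.nominalPairs N A Wset Δx Δw,
      MPC.SensitivityConditions P p.1 p.2 (ustar p.1 p.2) :=
    fun p ⟨xbar, wbar, ht⟩ => hcond xbar p.1 wbar p.2 ht
  refine ⟨fun p hp => (hcond' p hp).existsUnique_isSensitivity, fun S hS K hK hKA hxK => ?_⟩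
  have hScont : ContinuousOn (fun p : X × (Fin (N + 1) → W) => S p.1 p.2)
      (MPC.nominalPairs N A Wset Δx Δw) :=
    MPC.continuousOn_sensitivity (ustar := fun p => ustar p.1 p.2) hcont
      (fun p ⟨xbar, wbar, ht⟩ => hopt xbar p.1 wbar p.2 ht) hcond' hS
  have hT := MPC.isCompact_setOf_isTuple N hK hW Δx Δw
  have hTD : ∀ t ∈ {t : (X × (Fin (N + 1) → W)) × (X × (Fin (N + 1) → W)) |
      MPC.IsTuple K Wset Δx Δw t.1.1 t.2.1 t.1.2 t.2.2},
      t.2 ∈ MPC.nominalPairs N A Wset Δx Δw :=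
    fun t ht => ⟨t.1.1, t.1.2, MPC.IsTuple.mono hKA ht⟩
  have hstage0 : ∀ p ∈ MPC.nominalPairs N A Wset Δx Δw,
      ContDiffAt ℝ 1 (fun q : (X × (Fin (N + 1) → W)) × (Fin (N + 1) → U) =>
        P.stageCost q.1.1 (q.2 0) (q.1.2 0)) (p, ustar p.1 p.2) := fun p hp =>
    -- At time `0` the trajectory is by definition the initial value, so this is the stage cost at
    -- the data themselves.
    ((hcond' p hp).contDiffAt_stageCost 0).of_le (by norm_num)
  have hcost0 : ∀ p ∈ MPC.nominalPairs N A Wset Δx Δw,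
      ContDiffAt ℝ 1 (fun q : (X × (Fin (N + 1) → W)) × (Fin (N + 1) → U) =>
        P.cost q.1.1 q.2 q.1.2) (p, ustar p.1 p.2) := fun p hp =>
    (hcond' p hp).contDiffAt_cost.of_le (by norm_num)
  have hstagec : Continuous (fun q : (X × (Fin (N + 1) → W)) × (Fin (N + 1) → U) =>
      P.stageCost q.1.1 (q.2 0) (q.1.2 0)) :=
    hl.comp (f := fun q : (X × (Fin (N + 1) → W)) × (Fin (N + 1) → U) =>
      (q.1.1, q.2 0, q.1.2 0)) (by fun_prop)
  have hstage1 := MPC.exists_lipschitz_update hstagec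
    (v := fun p => ustar p.1 p.2) (S := fun p => S p.1 p.2) hcont hScont hstage0 hT hTD
  have hcostc := MPC.continuous_cost (N := N) hf hl
  have hcost1 := MPC.exists_lipschitz_update hcostc
    (v := fun p => ustar p.1 p.2) (S := fun p => S p.1 p.2) hcont hScont hcost0 hT hTD
  obtain ⟨Lℓ, hLℓ, hstage⟩ := hstage1
  obtain ⟨LJ, hLJ, hcost⟩ := hcost1
  -- The product carries the maximum distance, which is at most the sum in the assertion.
  have hdist : ∀ (xbar x : X) (wbar w : Fin (N + 1) → W),
      dist (xbar, wbar) (x, w) ≤ dist xbar x + dist wbar w := fun xbar x wbar w =>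
    max_le (le_add_of_nonneg_right dist_nonneg) (le_add_of_nonneg_left dist_nonneg)
  refine ⟨hxK, hKA.trans hA, Lℓ, LJ, hLℓ, hLJ, fun xbar x wbar w ht => ⟨?_, ?_⟩⟩
  · exact (hstage ((xbar, wbar), (x, w)) ht).trans
      (mul_le_mul_of_nonneg_left (hdist _ _ _ _) hLℓ)
  · exact (hcost ((xbar, wbar), (x, w)) ht).trans
      (mul_le_mul_of_nonneg_left (hdist _ _ _ _) hLJ)
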